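/- Let $A_1=\mathfrak{sl}(2,\mathbb C)$ and $A_2=\mathfrak{sl}(3,\mathbb C)$. Let $h_1,h_2,x_1,x_2,x_3,y_1,y_2,y_3$ be the Chevalley basis of $A_2$ determined by $$a h_1+b h_2+c x_1+d x_2+e x_3+c' y_1+d' y_2+e' y_3=\begin{pmatrix} a & c & -e\\ c' & b-a & d\\ -e' & d' & -b\end{pmatrix},$$ and write $\langle W_1,\dots,W_m\rangle$ for the subalgebra of $A_2$ generated by $W_1,\dots,W_m$. A Lie algebra is called Levi decomposable if it is the semidirect (possibly direct) sum $\mathfrak s\ltimes\mathfrak r$ of a nonzero semisimple subalgebra $\mathfrak s$ and a nonzero solvable ideal $\mathfrak r$. Two subalgebras $L,L'$ of $A_2$ are equivalent up to inner automorphism if $A^{-1}LA=L'$ for some $A\in SL(3,\mathbb C)$. Let $J$ and $K_1$ be the abelian Lie algebras over $\mathbb C$ of dimension $1$ and $2$ ($K_1$ with basis $z_1,z_2$), and let $L_2$ be the Lie algebra with basis $z_1,z_2,z_3$, $[z_3,z_1]=z_1$, $[z_3,z_2]=z_2$, $[z_1,z_2]=0$. Let $\chi:A_1\to A_2$ be the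 embedding $E_{12}\mapsto x_3$, $E_{21}\mapsto y_3$, $E_{11}-E_{22}\mapsto h_1+h_2$. Let $\psi_1:K_1\to A_2$ be $z_1\mapsto x_1$, $z_2\mapsto y_2$, and let $\psi_2:L_2\to A_2$ be $z_1\mapsto x_1$, $z_2\mapsto y_2$, $z_3\mapsto\frac13(h_1-h_2)$. Define $\varphi_1:A_1\to \mathrm{Der}(K_1)$ and $\varphi_2:A_1\to\mathrm{Der}(L_2)$ by $\varphi_i(M)(z)=\psi_i^{-1}([\chi(M),\psi_i(z)])$. **Theorem.** Put $A_1^1=\langle x_3,y_3,h_1+h_2\rangle$. Up to inner automorphism, $A_2$ has exactly five Levi decomposable subalgebras, namely $$\begin{aligned} A_1^1\oplus\langle h_1-h_2\rangle&\cong A_1\oplus J\;(\cong\mathfrak{gl}(2,\mathbb C)),\\ A_1^1\ltimes\langle x_1,y_2\rangle&\cong A_1\ltimes_{\varphi_1}K_1,\\ A_1^1\ltimes\langle x_2,y_1\rangle&\cong A_1\ltimes_{\varphi_1}K_1,\\ A_1^1\ltimes\langle h_1-h_2,x_1,y_2\rangle&\cong A_1\ltimes_{\varphi_2}L_2,\\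 A_1^1\ltimes\langle h_1-h_2,x_2,y_1\rangle&\cong A_1\ltimes_{\varphi_2}L_2. \end{aligned}$$ That is: each of these five is a Levi decomposable subalgebra of $A_2$, with the displayed (semi)direct sum decomposition and isomorphism; every Levi decomposable subalgebra of $A_2$ is equivalent to one of them; and no two of them are equivalent. The second and third have dimension $5$, the last two dimension $6$. Moreover, no subalgebra of $A_2$ containing the principal subalgebra $A_1^2=\langle x_1+x_2,\,2y_1+2y_2,\,2h_1+2h_2\rangle$ is Levi decomposable. -/

import Mathlib

open LieAlgebra LieAlgebra.SpecialLinear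

attribute [local instance 100] LieRing.ofAssociativeRing

noncomputable section

namespace LeviA2

/-- The Lie algebra `A₁` of traceless complex `2 × 2` matrices. -/
abbrev A1 : Type := sl (Fin 2) ℂ

/-- The Lie algebra `A₂` of traceless complex `3 × 3` matrices. -/
abbrev A2 : Type := sl (Fin 3) ℂ

/-! ### Chevalley basis of `A₂` -/

theorem mem_A2 {M : Matrix (Fin 3) (Fin 3) ℂ} (h : Matrix.trace M = 0) : M ∈ sl (Fin 3) ℂ :=
  LinearMap.mem_ker.2 h

/-- The matrix `a h₁ + b h₂ + c x₁ + d x₂ + e x₃ + c' y₁ + d' y₂ + e' y₃`. -/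
def chevalley (a b c d e c' d' e' : ℂ) : A2 :=
  ⟨!![a, c, -e; c', b - a, d; -e', d', -b], 
    mem_A2 (by simp [Matrix.trace_fin_three])⟩

def h₁ : A2 := chevalley 1 0 0 0 0 0 0 0
def h₂ : A2 := chevalley 0 1 0 0 0 0 0 0
def x₁ : A2 := chevalley 0 0 1 0 0 0 0 0
def x₂ : A2 := chevalley 0 0 0 1 0 0 0 0
def x₃ : A2 := chevalley 0 0 0 0 1 0 0 0
def y₁ : A2 := chevalley 0 0 0 0 0 1 0 0
def y₂ : A2 := chevalley 0 0 0 0 0 0 1 0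
def y₃ : A2 := chevalley 0 0 0 0 0 0 0 1

theorem chevalley_eq (a b c d e c' d' e' : ℂ) :
    chevalley a b c d e c' d' e' =
      a • h₁ + b • h₂ + c • x₁ + d • x₂ + e • x₃ + c' • y₁ + d' • y₂ + e' • y₃ := by
  apply Subtype.ext
  ext i j
  fin_cases i <;> fin_cases j <;>
    simp [chevalley, h₁, h₂, x₁, x₂, x₃, y₁, y₂, y₃] <;> ring

/-- `⟨W₁, …, W_m⟩`: the subalgebra of `A₂` generated by a set. -/
abbrev gen (W : Set A2) : LieSubalgebra ℂ A2 := LieSubalgebra.lieSpan ℂ A2 W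

/-- The copy `A₁¹` of `A₁` in `A₂`. -/
def A11 : LieSubalgebra ℂ A2 := gen {x₃, y₃, h₁ + h₂}

/-- The principal copy `A₁²` of `A₁` in `A₂`. -/
def A12 : LieSubalgebra ℂ A2 :=
  gen {x₁ + x₂, (2 : ℂ) • y₁ + (2 : ℂ) • y₂, (2 : ℂ) • h₁ + (2 : ℂ) • h₂}

/-! ### Equivalence up to inner automorphism -/

/-- The inner automorphism `X ↦ A⁻¹ X A` of `A₂` given by `A ∈ SL(3, ℂ)`. -/
def innerAut (A : Matrix.SpecialLinearGroup (Fin 3) ℂ) : A2 ≃ₗ⁅ℂ⁆ A2 where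
  toFun X := ⟨(A⁻¹).val * X.val * A.val, by
    have hX : Matrix.trace X.val = 0 := X.property
    have hA : A.val * (A⁻¹).val = 1 := by
      rw [← Matrix.SpecialLinearGroup.coe_mul, mul_inv_cancel, Matrix.SpecialLinearGroup.coe_one]
    apply mem_A2
    rw [Matrix.trace_mul_comm, ← mul_assoc, hA, one_mul, hX]⟩
  invFun X := ⟨A.val * X.val * (A⁻¹).val, by
    have hX : Matrix.trace X.val = 0 := X.property
    have hA : (A⁻¹).val * A.val = 1 := by
      rw [← Matrix.SpecialLinearGroup.coe_mul, inv_mul_cancel, Matrix.SpecialLinearGroup.coe_one]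
    apply mem_A2
    rw [Matrix.trace_mul_comm, ← mul_assoc, hA, one_mul, hX]⟩
  map_add' X Y := by
    apply Subtype.ext
    simp [mul_add, add_mul]
  map_smul' c X := by
    apply Subtype.ext
    simp
  map_lie' {X Y} := by
    have hA : A.val * (A⁻¹).val = 1 := by
      rw [← Matrix.SpecialLinearGroup.coe_mul, mul_inv_cancel, Matrix.SpecialLinearGroup.coe_one]
    have key : ∀ U V : Matrix (Fin 3) (Fin 3) ℂ,
        (A⁻¹).val * (U * V) * A.val
          = ((A⁻¹).val * U * A.val) * ((A⁻¹).val * V * A.val) := by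
      intro U V
      calc (A⁻¹).val * (U * V) * A.val = (A⁻¹).val * U * 1 * V * A.val := by
            simp only [mul_one, mul_assoc]
        _ = _ := by rw [← hA]; simp only [mul_assoc]
    apply Subtype.ext
    simp only [sl_bracket]
    rw [mul_sub, sub_mul, key, key]
  left_inv X := by
    have hA : A.val * (A⁻¹).val = 1 := by
      rw [← Matrix.SpecialLinearGroup.coe_mul, mul_inv_cancel, Matrix.SpecialLinearGroup.coe_one]
    apply Subtype.ext
    change A.val * ((A⁻¹).val * X.val * A.val) * (A⁻¹).val = X.val
    rw [mul_assoc, mul_assoc ((A⁻¹).val * X.val), hA, mul_one, ← mul_assoc, hA, one_mul]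
  right_inv X := by
    have hA : (A⁻¹).val * A.val = 1 := by
      rw [← Matrix.SpecialLinearGroup.coe_mul, inv_mul_cancel, Matrix.SpecialLinearGroup.coe_one]
    apply Subtype.ext
    change (A⁻¹).val * (A.val * X.val * (A⁻¹).val) * A.val = X.val
    rw [mul_assoc, mul_assoc (A.val * X.val), hA, mul_one, ← mul_assoc, hA, one_mul]

/-- Equivalence of subalgebras of `A₂` up to inner automorphism. -/
def Equivalent (L L' : LieSubalgebra ℂ A2) : Prop :=
  ∃ A : Matrix.SpecialLinearGroup (Fin 3) ℂ, L.map (innerAut A).toLieHom = L'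

/-! ### Levi decomposable subalgebras -/

section Levi

variable {g : Type*} [LieRing g] [LieAlgebra ℂ g]

/-- `L` is the (internal) semidirect sum of its subalgebra `S` and its ideal `R`. -/
structure IsSemidirectSum (S R L : LieSubalgebra ℂ g) : Prop where
  inf_eq_bot : S.toSubmodule ⊓ R.toSubmodule = ⊥
  sup_eq : S.toSubmodule ⊔ R.toSubmodule = L.toSubmodule
  ideal : ∀ x ∈ L, ∀ y ∈ R, ⁅x, y⁆ ∈ R

/-- `L` is the (internal) direct sum of its ideals `S` and `R`. -/
structure IsDirectSum (S R L : LieSubalgebra ℂ g) : Prop extends IsSemidirectSum S R L where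
  commute : ∀ x ∈ S, ∀ y ∈ R, ⁅x, y⁆ = 0

/-- `L` is Levi decomposable: it is the semidirect (possibly direct) sum of a nonzero semisimple
subalgebra and a nonzero solvable ideal. -/
def IsLeviDecomposable (L : LieSubalgebra ℂ g) : Prop :=
  ∃ S R : LieSubalgebra ℂ g, S ≠ ⊥ ∧ R ≠ ⊥ ∧
    LieAlgebra.IsSemisimple ℂ S ∧ LieAlgebra.IsSolvable R ∧ IsSemidirectSum S R L

end Levi

/-- The radicals in the list of Levi decomposable subalgebras. -/
def radicalPart : Fin 5 → LieSubalgebra ℂ A2 :=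
  ![gen {h₁ - h₂}, gen {x₁, y₂}, gen {x₂, y₁}, gen {h₁ - h₂, x₁, y₂}, gen {h₁ - h₂, x₂, y₁}]

/-- The list of Levi decomposable subalgebras of `A₂`. -/
def leviSubalgebra (i : Fin 5) : LieSubalgebra ℂ A2 := A11 ⊔ radicalPart i

/-! ### The abstract Lie algebras `J`, `K₁`, `L₂` -/

/-- The one-dimensional abelian Lie algebra. -/
def J : Type := ℂ

instance : AddCommGroup J := inferInstanceAs (AddCommGroup ℂ)
instance : Module ℂ J := inferInstanceAs (Module ℂ ℂ)
instance : LieRing J where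
  bracket _ _ := 0
  add_lie _ _ _ := (add_zero _).symm
  lie_add _ _ _ := (add_zero _).symm
  lie_self _ := rfl
  leibniz_lie _ _ _ := (add_zero _).symm
instance : LieAlgebra ℂ J where
  lie_smul _ _ _ := (smul_zero _).symm

/-- The two-dimensional abelian Lie algebra; `u` stands for `u 0 • z₁ + u 1 • z₂`. -/
def K1 : Type := Fin 2 → ℂ

instance : AddCommGroup K1 := inferInstanceAs (AddCommGroup (Fin 2 → ℂ))
instance : Module ℂ K1 := inferInstanceAs (Module ℂ (Fin 2 → ℂ))
instance : LieRing K1 where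
  bracket _ _ := 0
  add_lie _ _ _ := (add_zero _).symm
  lie_add _ _ _ := (add_zero _).symm
  lie_self _ := rfl
  leibniz_lie _ _ _ := (add_zero _).symm
instance : LieAlgebra ℂ K1 where
  lie_smul _ _ _ := (smul_zero _).symm

/-- The Lie algebra `L₂` with basis `z₁, z₂, z₃` and `[z₃, z₁] = z₁`, `[z₃, z₂] = z₂`,
`[z₁, z₂] = 0`; `u` stands for `u 0 • z₁ + u 1 • z₂ + u 2 • z₃`. -/
def L2 : Type := Fin 3 → ℂ

instance : AddCommGroup L2 := inferInstanceAs (AddCommGroup (Fin 3 → ℂ))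
instance : Module ℂ L2 := inferInstanceAs (Module ℂ (Fin 3 → ℂ))

/-- The underlying bilinear operation of the bracket of `L₂`. -/
def bracketL2 (u v : Fin 3 → ℂ) : Fin 3 → ℂ :=
  ![u 2 * v 0 - v 2 * u 0, u 2 * v 1 - v 2 * u 1, 0]

instance : LieRing L2 where
  bracket u v := bracketL2 u v
  add_lie u v w := by
    have key : ∀ u v w : Fin 3 → ℂ, bracketL2 (u + v) w = bracketL2 u w + bracketL2 v w := by
      intro u v w; ext i; fin_cases i <;> simp [bracketL2] <;> ring
    exact key u v w
  lie_add u v w := by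
    have key : ∀ u v w : Fin 3 → ℂ, bracketL2 u (v + w) = bracketL2 u v + bracketL2 u w := by
      intro u v w; ext i; fin_cases i <;> simp [bracketL2] <;> ring
    exact key u v w
  lie_self u := by
    change bracketL2 u u = (0 : Fin 3 → ℂ)
    ext i; fin_cases i <;> simp [bracketL2]
  leibniz_lie u v w := by
    change bracketL2 u (bracketL2 v w)
      = (bracketL2 (bracketL2 u v) w + bracketL2 v (bracketL2 u w) : Fin 3 → ℂ)
    ext i; fin_cases i <;> simp [bracketL2] <;> ring
instance : LieAlgebra ℂ L2 where
  lie_smul c u v := by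
    have key : ∀ u v : Fin 3 → ℂ, bracketL2 u (c • v) = c • bracketL2 u v := by
      intro u v; ext i; fin_cases i <;> simp [bracketL2] <;> ring
    exact key u v

/-! ### The actions `φ₁` and `φ₂` -/

/-- The action of a `2 × 2` matrix on `K₁`. -/
def actK1 (M : Matrix (Fin 2) (Fin 2) ℂ) (u : Fin 2 → ℂ) : Fin 2 → ℂ :=
  ![M 0 0 * u 0 - M 0 1 * u 1, -M 1 0 * u 0 + M 1 1 * u 1]

/-- The action of a `2 × 2` matrix on `L₂`. -/
def actL2 (M : Matrix (Fin 2) (Fin 2) ℂ) (u : Fin 3 → ℂ) : Fin 3 → ℂ :=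
  ![M 0 0 * u 0 - M 0 1 * u 1, -M 1 0 * u 0 + M 1 1 * u 1, 0]

/-- `φ₁ : A₁ → Der(K₁)`; see `psi1_phi1` for its characterisation. -/
def phi1 : A1 →ₗ⁅ℂ⁆ LieDerivation ℂ K1 K1 where
  toFun M :=
    { toFun := fun u => actK1 M.val u
      map_add' := fun u v => by
        have key : ∀ u v : Fin 2 → ℂ, actK1 M.val (u + v) = actK1 M.val u + actK1 M.val v := by
          intro u v; ext i; fin_cases i <;> simp [actK1] <;> ring
        exact key u v
      map_smul' := fun c u => by
        have key : ∀ u : Fin 2 → ℂ, actK1 M.val (c • u) = c • actK1 M.val u := by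
          intro u; ext i; fin_cases i <;> simp [actK1] <;> ring
        exact key u
      leibniz' := fun u v => by
        change actK1 M.val (0 : Fin 2 → ℂ) = (0 - 0 : Fin 2 → ℂ)
        ext i; fin_cases i <;> simp [actK1] }
  map_add' M N := by
    ext u
    change actK1 (M.val + N.val) u = (actK1 M.val u + actK1 N.val u : Fin 2 → ℂ)
    ext i; fin_cases i <;> simp [actK1] <;> ring
  map_smul' c M := by
    ext u
    change actK1 (c • M.val) u = (c • actK1 M.val u : Fin 2 → ℂ)
    ext i; fin_cases i <;> simp [actK1] <;> ring
  map_lie' {M N} := by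
    ext u
    change actK1 (M.val * N.val - N.val * M.val) u
      = (actK1 M.val (actK1 N.val u) - actK1 N.val (actK1 M.val u) : Fin 2 → ℂ)
    ext i; fin_cases i <;> simp [actK1, Matrix.mul_apply, Fin.sum_univ_two] <;> ring

/-- `φ₂ : A₁ → Der(L₂)`; see `psi2_phi2` for its characterisation. -/
def phi2 : A1 →ₗ⁅ℂ⁆ LieDerivation ℂ L2 L2 where
  toFun M :=
    { toFun := fun u => actL2 M.val u
      map_add' := fun u v => by
        have key : ∀ u v : Fin 3 → ℂ, actL2 M.val (u + v) = actL2 M.val u + actL2 M.val v := by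
          intro u v; ext i; fin_cases i <;> simp [actL2] <;> ring
        exact key u v
      map_smul' := fun c u => by
        have key : ∀ u : Fin 3 → ℂ, actL2 M.val (c • u) = c • actL2 M.val u := by
          intro u; ext i; fin_cases i <;> simp [actL2] <;> ring
        exact key u
      leibniz' := fun u v => by
        change actL2 M.val (bracketL2 u v)
          = (bracketL2 u (actL2 M.val v) - bracketL2 v (actL2 M.val u) : Fin 3 → ℂ)
        ext i; fin_cases i <;> simp [actL2, bracketL2] <;> ring }
  map_add' M N := by
    ext u
    change actL2 (M.val + N.val) u = (actL2 M.val u + actL2 N.val u : Fin 3 → ℂ)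
    ext i; fin_cases i <;> simp [actL2] <;> ring
  map_smul' c M := by
    ext u
    change actL2 (c • M.val) u = (c • actL2 M.val u : Fin 3 → ℂ)
    ext i; fin_cases i <;> simp [actL2] <;> ring
  map_lie' {M N} := by
    ext u
    change actL2 (M.val * N.val - N.val * M.val) u
      = (actL2 M.val (actL2 N.val u) - actL2 N.val (actL2 M.val u) : Fin 3 → ℂ)
    ext i; fin_cases i <;> simp [actL2, Matrix.mul_apply, Fin.sum_univ_two] <;> ring

/-- The linear map `χ : A₁ → A₂`, `x ↦ x₃`, `y ↦ y₃`, `h ↦ h₁ + h₂`, for the Chevalley basis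
`x = E₁₂`, `y = E₂₁`, `h = E₁₁ - E₂₂` of `A₁`. -/
def chi (M : A1) : A2 := M.val 0 1 • x₃ + M.val 1 0 • y₃ + M.val 0 0 • (h₁ + h₂)

/-- `ψ₁ : z₁ ↦ x₁, z₂ ↦ y₂`. -/
def psi1 (u : K1) : A2 := (u : Fin 2 → ℂ) 0 • x₁ + (u : Fin 2 → ℂ) 1 • y₂

/-- `ψ₂ : z₁ ↦ x₁, z₂ ↦ y₂, z₃ ↦ (h₁ - h₂) / 3`. -/
def psi2 (u : L2) : A2 :=
  (u : Fin 3 → ℂ) 0 • x₁ + (u : Fin 3 → ℂ) 1 • y₂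
    + (u : Fin 3 → ℂ) 2 • ((1 / 3 : ℂ) • (h₁ - h₂))

/-- `φ₁(M)(z) = ψ₁⁻¹([χ(M), ψ₁(z)])`. -/
theorem psi1_phi1 (M : A1) (u : K1) : psi1 (phi1 M u) = ⁅chi M, psi1 u⁆ := by
  have hM : M.val 1 1 = - M.val 0 0 := by
    have h : Matrix.trace M.val = 0 := M.property
    rw [Matrix.trace_fin_two] at h
    linear_combination h
  have h0 : (phi1 M u : Fin 2 → ℂ) = actK1 M.val u := rfl
  apply Subtype.ext
  rw [sl_bracket]
  ext i j
  fin_cases i <;> fin_cases j <;>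
    simp [psi1, chi, h0, actK1, chevalley, h₁, h₂, x₁, x₃, y₂, y₃, hM,
      Matrix.mul_apply, Fin.sum_univ_three] <;> ring

/-- `φ₂(M)(z) = ψ₂⁻¹([χ(M), ψ₂(z)])`. -/
theorem psi2_phi2 (M : A1) (u : L2) : psi2 (phi2 M u) = ⁅chi M, psi2 u⁆ := by
  have hM : M.val 1 1 = - M.val 0 0 := by
    have h : Matrix.trace M.val = 0 := M.property
    rw [Matrix.trace_fin_two] at h
    linear_combination h
  have h0 : (phi2 M u : Fin 3 → ℂ) = actL2 M.val u := rfl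
  apply Subtype.ext
  rw [sl_bracket]
  ext i j
  fin_cases i <;> fin_cases j <;>
    simp [psi2, chi, h0, actL2, chevalley, h₁, h₂, x₁, x₃, y₂, y₃, hM,
      Matrix.mul_apply, Fin.sum_univ_three] <;> ring

end LeviA2

end

open LeviA2

noncomputable section

namespace LeviA2

/-! ### Subalgebras of `A₂` cut out by conditions on the matrix entries -/

/-! Everything is read off from the action of `A2` on ℂ³. The algebra `leviSubalgebra 4` is the
stabiliser of the line spanned by the middle basis vector, `leviSubalgebra 3` the stabiliser of the
complementary coordinate plane, and `leviSubalgebra 0` stabilises both; numbers 2 and 1 are the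
parts of 4 and 3 whose middle diagonal entry vanishes. The outer automorphism X ↦ -Xᵀ passes to the
dual of ℂ³, so it exchanges lines with planes, 1 with 2 and 3 with 4.

Let L be Levi decomposable with Levi part S and solvable ideal R. By Lie's theorem R has a weight
space in ℂ³; it is stable under L because R is an ideal, and it is proper because a nonzero
traceless matrix is not scalar. Hence L fixes a line or a plane
(`IsLeviDecomposable.hasInvariantLine`). The principal subalgebra fixes neither, which excludes
everything above it. Up to X ↦ -Xᵀ and conjugation, then, L lies in `leviSubalgebra 4`.

The radical of that stabiliser has quotient 𝔰𝔩(2). Having no abelian ideal, S meets the radical in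
zero and has dimension at least 3, so it maps isomorphically onto the quotient. Lifting a standard
triple and diagonalising its semisimple element by a unipotent matrix moves S so that it contains
`A11` (`NoAbelianIdeal.exists_A11_le`); this is Malcev's conjugacy theorem made explicit. Under
`A11` the stabiliser splits into `A11`, a trivial line and an irreducible plane, pairwise
non-isomorphic, so only `A11` and numbers 0, 2 and 4 lie in between (`eq_levi_of_A11_le`), and `A11`
is excluded because R is nonzero.

The five are told apart by their dimension and by the existence of an invariant line. -/

theorem A2_ext {X Y : A2} (h : ∀ i j, X.val i j = Y.val i j) : X = Y :=
  Subtype.ext (Matrix.ext h)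

theorem trace_entries (X : A2) : X.val 0 0 + X.val 1 1 + X.val 2 2 = 0 := by
  have h : Matrix.trace X.val = 0 := X.property
  rwa [Matrix.trace_fin_three] at h

theorem entry_two_two (X : A2) : X.val 2 2 = -X.val 0 0 - X.val 1 1 := by
  linear_combination trace_entries X

theorem lie_apply (X Y : A2) (i j : Fin 3) :
    (⁅X, Y⁆ : A2).val i j = (X.val i 0 * Y.val 0 j + X.val i 1 * Y.val 1 j + X.val i 2 * Y.val 2 j)
      - (Y.val i 0 * X.val 0 j + Y.val i 1 * X.val 1 j + Y.val i 2 * X.val 2 j) := by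
  rw [sl_bracket, Matrix.sub_apply, Matrix.mul_apply, Matrix.mul_apply, Fin.sum_univ_three,
    Fin.sum_univ_three]

theorem eq_chevalley (X : A2) :
    X = (X.val 0 0) • h₁ + (-X.val 2 2) • h₂ + (X.val 0 1) • x₁ + (X.val 1 2) • x₂
      + (-X.val 0 2) • x₃ + (X.val 1 0) • y₁ + (X.val 2 1) • y₂ + (-X.val 2 0) • y₃ := by
  rw [← chevalley_eq]
  apply A2_ext
  have h := trace_entries X
  intro i j
  fin_cases i <;> fin_cases j <;> simp [chevalley]
  linear_combination h

theorem mem_gen {W : Set A2} {X : A2} (h : X ∈ W) : X ∈ gen W := LieSubalgebra.subset_lieSpan h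

/-- The subalgebra of `A₂` defined by a property of matrices that is stable under linear
combinations and commutators. -/
def entryAlg (p : Matrix (Fin 3) (Fin 3) ℂ → Prop) (h0 : p 0)
    (hadd : ∀ X Y, p X → p Y → p (X + Y)) (hsmul : ∀ (c : ℂ) X, p X → p (c • X))
    (hlie : ∀ X Y, p X → p Y → p (X * Y - Y * X)) : LieSubalgebra ℂ A2 where
  carrier := {X | p X.val}
  zero_mem' := h0
  add_mem' hX hY := hadd _ _ hX hY
  smul_mem' c _ hX := hsmul c _ hX
  lie_mem' {X Y} hX hY := by
    change p (⁅X, Y⁆ : A2).val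
    rw [sl_bracket]
    exact hlie _ _ hX hY

/-- Pattern for all membership criteria below: generators satisfy the entry conditions, which are
closed under brackets, and conversely a matrix satisfying them is an explicit element of the
generated algebra. -/
theorem mem_iff_of_le_entryAlg {p : Matrix (Fin 3) (Fin 3) ℂ → Prop} {h0 hadd hsmul hlie}
    {L : LieSubalgebra ℂ A2} (h1 : L ≤ entryAlg p h0 hadd hsmul hlie) (h2 : ∀ X : A2, p X.val → X ∈ L)
    (X : A2) : X ∈ L ↔ p X.val :=
  ⟨fun h => h1 h, h2 X⟩

theorem mem_A11 (X : A2) : X ∈ A11 ↔ X.val 0 1 = 0 ∧ X.val 2 1 = 0 ∧ X.val 1 0 = 0 ∧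
    X.val 1 2 = 0 ∧ X.val 1 1 = 0 := by
  refine mem_iff_of_le_entryAlg (p := fun X => X 0 1 = 0 ∧ X 2 1 = 0 ∧ X 1 0 = 0 ∧ X 1 2 = 0 ∧ X 1 1 = 0)
    (h0 := by simp) (hadd := by simp +contextual) (hsmul := by simp +contextual)
    (hlie := by simp +contextual [Matrix.mul_apply, Fin.sum_univ_three])
    (LieSubalgebra.lieSpan_le.2 ?_) ?_ X
  · rintro X (rfl | rfl | rfl) <;>
      simp [entryAlg, x₃, y₃, h₁, h₂, chevalley]
  · rintro X ⟨h1, h2, h3, h4, h5⟩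
    have e : X = (-X.val 0 2) • x₃ + (-X.val 2 0) • y₃ + X.val 0 0 • (h₁ + h₂) := by
      apply A2_ext
      intro i j
      fin_cases i <;> fin_cases j <;>
        simp [chevalley, x₃, y₃, h₁, h₂, h1, h2, h3, h4, h5, entry_two_two X]
    rw [e]
    exact add_mem (add_mem (A11.smul_mem _ (mem_gen (by simp))) (A11.smul_mem _ (mem_gen (by simp))))
      (A11.smul_mem _ (mem_gen (by simp)))

theorem mem_rad0 (X : A2) : X ∈ gen {h₁ - h₂} ↔ X.val 0 1 = 0 ∧ X.val 2 1 = 0 ∧ X.val 1 0 = 0 ∧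
    X.val 1 2 = 0 ∧ X.val 0 2 = 0 ∧ X.val 2 0 = 0 ∧ X.val 0 0 = X.val 2 2 := by
  refine mem_iff_of_le_entryAlg (p := fun X => X 0 1 = 0 ∧ X 2 1 = 0 ∧ X 1 0 = 0 ∧ X 1 2 = 0 ∧
    X 0 2 = 0 ∧ X 2 0 = 0 ∧ X 0 0 = X 2 2)
    (h0 := by simp) (hadd := by simp +contextual) (hsmul := by simp +contextual)
    (hlie := by simp +contextual [Matrix.mul_apply, Fin.sum_univ_three, mul_comm])
    (LieSubalgebra.lieSpan_le.2 ?_) ?_ X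
  · rintro X rfl
    simp [entryAlg, h₁, h₂, chevalley]
  · rintro X ⟨h1, h2, h3, h4, h5, h6, h7⟩
    have e : X = X.val 0 0 • (h₁ - h₂) := by
      apply A2_ext
      have h := trace_entries X
      intro i j
      fin_cases i <;> fin_cases j <;>
        simp [chevalley, h₁, h₂, h1, h2, h3, h4, h5, h6, ← h7]
      linear_combination h + h7
    rw [e]
    exact LieSubalgebra.smul_mem _ _ (mem_gen (by simp))

theorem mem_rad1 (X : A2) : X ∈ gen {x₁, y₂} ↔ X.val 0 0 = 0 ∧ X.val 0 2 = 0 ∧ X.val 2 0 = 0 ∧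
    X.val 1 0 = 0 ∧ X.val 1 2 = 0 ∧ X.val 1 1 = 0 := by
  refine mem_iff_of_le_entryAlg (p := fun X => X 0 0 = 0 ∧ X 0 2 = 0 ∧ X 2 0 = 0 ∧ X 1 0 = 0 ∧
    X 1 2 = 0 ∧ X 1 1 = 0) (h0 := by simp) (hadd := by simp +contextual) (hsmul := by simp +contextual)
    (hlie := by simp +contextual [Matrix.mul_apply, Fin.sum_univ_three])
    (LieSubalgebra.lieSpan_le.2 ?_) ?_ X
  · rintro X (rfl | rfl) <;> simp [entryAlg, x₁, y₂, chevalley]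
  · rintro X ⟨h1, h2, h3, h4, h5, h6⟩
    have e : X = X.val 0 1 • x₁ + X.val 2 1 • y₂ := by
      apply A2_ext
      intro i j
      fin_cases i <;> fin_cases j <;>
        simp [chevalley, x₁, y₂, h1, h2, h3, h4, h5, h6, entry_two_two X]
    rw [e]
    exact add_mem (LieSubalgebra.smul_mem _ _ (mem_gen (by simp)))
      (LieSubalgebra.smul_mem _ _ (mem_gen (by simp)))

theorem mem_rad2 (X : A2) : X ∈ gen {x₂, y₁} ↔ X.val 0 0 = 0 ∧ X.val 0 2 = 0 ∧ X.val 2 0 = 0 ∧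
    X.val 0 1 = 0 ∧ X.val 2 1 = 0 ∧ X.val 1 1 = 0 := by
  refine mem_iff_of_le_entryAlg (p := fun X => X 0 0 = 0 ∧ X 0 2 = 0 ∧ X 2 0 = 0 ∧ X 0 1 = 0 ∧
    X 2 1 = 0 ∧ X 1 1 = 0) (h0 := by simp) (hadd := by simp +contextual) (hsmul := by simp +contextual)
    (hlie := by simp +contextual [Matrix.mul_apply, Fin.sum_univ_three])
    (LieSubalgebra.lieSpan_le.2 ?_) ?_ X
  · rintro X (rfl | rfl) <;> simp [entryAlg, x₂, y₁, chevalley]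
  · rintro X ⟨h1, h2, h3, h4, h5, h6⟩
    have e : X = X.val 1 2 • x₂ + X.val 1 0 • y₁ := by
      apply A2_ext
      intro i j
      fin_cases i <;> fin_cases j <;>
        simp [chevalley, x₂, y₁, h1, h2, h3, h4, h5, h6, entry_two_two X]
    rw [e]
    exact add_mem (LieSubalgebra.smul_mem _ _ (mem_gen (by simp)))
      (LieSubalgebra.smul_mem _ _ (mem_gen (by simp)))

theorem mem_rad3 (X : A2) : X ∈ gen {h₁ - h₂, x₁, y₂} ↔ X.val 0 2 = 0 ∧ X.val 2 0 = 0 ∧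
    X.val 1 0 = 0 ∧ X.val 1 2 = 0 ∧ X.val 0 0 = X.val 2 2 := by
  refine mem_iff_of_le_entryAlg (p := fun X => X 0 2 = 0 ∧ X 2 0 = 0 ∧ X 1 0 = 0 ∧
    X 1 2 = 0 ∧ X 0 0 = X 2 2)
    (h0 := by simp) (hadd := by simp +contextual) (hsmul := by simp +contextual)
    (hlie := by simp +contextual [Matrix.mul_apply, Fin.sum_univ_three, mul_comm])
    (LieSubalgebra.lieSpan_le.2 ?_) ?_ X
  · rintro X (rfl | rfl | rfl) <;> simp [entryAlg, h₁, h₂, x₁, y₂, chevalley]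
  · rintro X ⟨h1, h2, h3, h4, h7⟩
    have e : X = X.val 0 0 • (h₁ - h₂) + X.val 0 1 • x₁ + X.val 2 1 • y₂ := by
      apply A2_ext
      have h := trace_entries X
      intro i j
      fin_cases i <;> fin_cases j <;>
        simp [chevalley, h₁, h₂, x₁, y₂, h1, h2, h3, h4, ← h7]
      linear_combination h + h7
    rw [e]
    exact add_mem (add_mem (LieSubalgebra.smul_mem _ _ (mem_gen (by simp)))
      (LieSubalgebra.smul_mem _ _ (mem_gen (by simp))))
      (LieSubalgebra.smul_mem _ _ (mem_gen (by simp)))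

theorem mem_rad4 (X : A2) : X ∈ gen {h₁ - h₂, x₂, y₁} ↔ X.val 0 2 = 0 ∧ X.val 2 0 = 0 ∧
    X.val 0 1 = 0 ∧ X.val 2 1 = 0 ∧ X.val 0 0 = X.val 2 2 := by
  refine mem_iff_of_le_entryAlg (p := fun X => X 0 2 = 0 ∧ X 2 0 = 0 ∧ X 0 1 = 0 ∧
    X 2 1 = 0 ∧ X 0 0 = X 2 2)
    (h0 := by simp) (hadd := by simp +contextual) (hsmul := by simp +contextual)
    (hlie := by simp +contextual [Matrix.mul_apply, Fin.sum_univ_three, mul_comm])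
    (LieSubalgebra.lieSpan_le.2 ?_) ?_ X
  · rintro X (rfl | rfl | rfl) <;> simp [entryAlg, h₁, h₂, x₂, y₁, chevalley]
  · rintro X ⟨h1, h2, h3, h4, h7⟩
    have e : X = X.val 0 0 • (h₁ - h₂) + X.val 1 2 • x₂ + X.val 1 0 • y₁ := by
      apply A2_ext
      have h := trace_entries X
      intro i j
      fin_cases i <;> fin_cases j <;>
        simp [chevalley, h₁, h₂, x₂, y₁, h1, h2, h3, h4, ← h7]
      linear_combination h + h7
    rw [e]
    exact add_mem (add_mem (LieSubalgebra.smul_mem _ _ (mem_gen (by simp)))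
      (LieSubalgebra.smul_mem _ _ (mem_gen (by simp))))
      (LieSubalgebra.smul_mem _ _ (mem_gen (by simp)))

/-- The component in `A₁¹` of a matrix. -/
def blockPart (X : A2) : A2 :=
  (-X.val 0 2) • x₃ + (-X.val 2 0) • y₃ + ((X.val 0 0 - X.val 2 2) / 2) • (h₁ + h₂)

theorem blockPart_mem (X : A2) : blockPart X ∈ A11 := by
  rw [mem_A11]
  simp [blockPart, x₃, y₃, h₁, h₂, chevalley]

/-- Both joins are needed: `leviSubalgebra` is a join of Lie subalgebras, which a priori may exceed
the sum of subspaces demanded by `IsSemidirectSum`. -/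
theorem mem_sup_of_sub_blockPart {R : LieSubalgebra ℂ A2} {X : A2} (h : X - blockPart X ∈ R) :
    X ∈ A11 ⊔ R ∧ X ∈ A11.toSubmodule ⊔ R.toSubmodule := by
  have e : X = blockPart X + (X - blockPart X) := by abel
  constructor
  · rw [e]
    exact add_mem ((le_sup_left : A11 ≤ A11 ⊔ R) (blockPart_mem X))
      ((le_sup_right : R ≤ A11 ⊔ R) h)
  · rw [e]
    exact Submodule.add_mem_sup (blockPart_mem X) h

/-- In this and the next four criteria, zeros off the diagonal in the middle column mean that the
line of the middle basis vector is stable; zeros off the diagonal in the middle row mean that the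
complementary coordinate plane is stable. -/
theorem mem_levi0 (X : A2) : X ∈ leviSubalgebra 0 ↔ X.val 0 1 = 0 ∧ X.val 2 1 = 0 ∧
    X.val 1 0 = 0 ∧ X.val 1 2 = 0 := by
  refine mem_iff_of_le_entryAlg (p := fun X => X 0 1 = 0 ∧ X 2 1 = 0 ∧ X 1 0 = 0 ∧ X 1 2 = 0)
    (h0 := by simp) (hadd := by simp +contextual) (hsmul := by simp +contextual)
    (hlie := by simp +contextual [Matrix.mul_apply, Fin.sum_univ_three]) (sup_le ?_ ?_) ?_ X
  · intro X hX
    rw [mem_A11] at hX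
    exact ⟨hX.1, hX.2.1, hX.2.2.1, hX.2.2.2.1⟩
  · intro X hX
    have hX := (mem_rad0 X).1 hX
    exact ⟨hX.1, hX.2.1, hX.2.2.1, hX.2.2.2.1⟩
  · rintro X ⟨h1, h2, h3, h4⟩
    refine (mem_sup_of_sub_blockPart ((mem_rad0 _).2 ?_)).1
    simp [blockPart, x₃, y₃, h₁, h₂, chevalley, h1, h2, h3, h4]
    ring

theorem mem_levi1 (X : A2) : X ∈ leviSubalgebra 1 ↔ X.val 1 0 = 0 ∧ X.val 1 2 = 0 ∧
    X.val 1 1 = 0 := by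
  refine mem_iff_of_le_entryAlg (p := fun X => X 1 0 = 0 ∧ X 1 2 = 0 ∧ X 1 1 = 0)
    (h0 := by simp) (hadd := by simp +contextual) (hsmul := by simp +contextual)
    (hlie := by simp +contextual [Matrix.mul_apply, Fin.sum_univ_three]) (sup_le ?_ ?_) ?_ X
  · intro X hX
    rw [mem_A11] at hX
    exact hX.2.2
  · intro X hX
    have hX := (mem_rad1 X).1 hX
    exact hX.2.2.2
  · rintro X ⟨h1, h2, h3⟩
    refine (mem_sup_of_sub_blockPart ((mem_rad1 _).2 ?_)).1
    simp [blockPart, x₃, y₃, h₁, h₂, chevalley, h1, h2, h3, entry_two_two X]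

theorem mem_levi2 (X : A2) : X ∈ leviSubalgebra 2 ↔ X.val 0 1 = 0 ∧ X.val 2 1 = 0 ∧
    X.val 1 1 = 0 := by
  refine mem_iff_of_le_entryAlg (p := fun X => X 0 1 = 0 ∧ X 2 1 = 0 ∧ X 1 1 = 0)
    (h0 := by simp) (hadd := by simp +contextual) (hsmul := by simp +contextual)
    (hlie := by simp +contextual [Matrix.mul_apply, Fin.sum_univ_three]) (sup_le ?_ ?_) ?_ X
  · intro X hX
    rw [mem_A11] at hX
    exact ⟨hX.1, hX.2.1, hX.2.2.2.2⟩
  · intro X hX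
    have hX := (mem_rad2 X).1 hX
    exact hX.2.2.2
  · rintro X ⟨h1, h2, h3⟩
    refine (mem_sup_of_sub_blockPart ((mem_rad2 _).2 ?_)).1
    simp [blockPart, x₃, y₃, h₁, h₂, chevalley, h1, h2, h3, entry_two_two X]

theorem mem_levi3 (X : A2) : X ∈ leviSubalgebra 3 ↔ X.val 1 0 = 0 ∧ X.val 1 2 = 0 := by
  refine mem_iff_of_le_entryAlg (p := fun X => X 1 0 = 0 ∧ X 1 2 = 0)
    (h0 := by simp) (hadd := by simp +contextual) (hsmul := by simp +contextual)
    (hlie := by simp +contextual [Matrix.mul_apply, Fin.sum_univ_three]) (sup_le ?_ ?_) ?_ X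
  · intro X hX
    rw [mem_A11] at hX
    exact ⟨hX.2.2.1, hX.2.2.2.1⟩
  · intro X hX
    have hX := (mem_rad3 X).1 hX
    exact ⟨hX.2.2.1, hX.2.2.2.1⟩
  · rintro X ⟨h1, h2⟩
    refine (mem_sup_of_sub_blockPart ((mem_rad3 _).2 ?_)).1
    simp [blockPart, x₃, y₃, h₁, h₂, chevalley, h1, h2]
    ring

theorem mem_levi4 (X : A2) : X ∈ leviSubalgebra 4 ↔ X.val 0 1 = 0 ∧ X.val 2 1 = 0 := by
  refine mem_iff_of_le_entryAlg (p := fun X => X 0 1 = 0 ∧ X 2 1 = 0)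
    (h0 := by simp) (hadd := by simp +contextual) (hsmul := by simp +contextual)
    (hlie := by simp +contextual [Matrix.mul_apply, Fin.sum_univ_three]) (sup_le ?_ ?_) ?_ X
  · intro X hX
    rw [mem_A11] at hX
    exact ⟨hX.1, hX.2.1⟩
  · intro X hX
    have hX := (mem_rad4 X).1 hX
    exact ⟨hX.2.2.1, hX.2.2.2.1⟩
  · rintro X ⟨h1, h2⟩
    refine (mem_sup_of_sub_blockPart ((mem_rad4 _).2 ?_)).1
    simp [blockPart, x₃, y₃, h₁, h₂, chevalley, h1, h2]
    ring

/-! ### The five subalgebras are Levi decomposable -/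

/-- The hypothesis says that the second derived algebra vanishes, tested on brackets, which span the
first. -/
theorem isSolvable_of_lie_lie_lie_eq_zero {L : Type*} [LieRing L] [LieAlgebra ℂ L]
    (h : ∀ x y z w : L, ⁅⁅x, y⁆, ⁅z, w⁆⁆ = 0) : LieAlgebra.IsSolvable L := by
  apply LieAlgebra.IsSolvable.mk (R := ℂ) (k := 2)
  change ⁅LieAlgebra.derivedSeries ℂ L 1, LieAlgebra.derivedSeries ℂ L 1⁆ = ⊥
  rw [LieSubmodule.lie_eq_bot_iff]
  intro x hx m hm
  rw [← LieSubmodule.mem_toSubmodule] at hx hm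
  have e := LieAlgebra.coe_derivedSeries_one_eq ℂ L
  simp only [LieIdeal.toLieSubalgebra_toSubmodule] at e
  rw [e] at hx hm
  induction hx, hm using Submodule.span_induction₂ with
  | mem_mem x y hx hy =>
    obtain ⟨a, b, rfl⟩ := hx
    obtain ⟨c, d, rfl⟩ := hy
    exact h a b c d
  | zero_left y hy => simp
  | zero_right x hx => simp
  | add_left x y z _ _ _ h1 h2 => rw [add_lie, h1, h2, add_zero]
  | add_right x y z _ _ _ h1 h2 => rw [lie_add, h1, h2, add_zero]
  | smul_left r x y _ _ h => rw [smul_lie, h, smul_zero]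
  | smul_right r x y _ _ h => rw [lie_smul, h, smul_zero]

/-- For a nonzero x = ae + bf + ch in an ideal, applying ad e twice gives -2be and applying ad f
twice gives -2af; if a = b = 0, then x is a multiple of h. So the ideal contains one of e, f, h, and
any one of them generates the rest. -/
theorem isSimple_of_sl2_basis {L : Type*} [LieRing L] [LieAlgebra ℂ L] {e f h : L}
    (hef : ⁅e, f⁆ = h) (hhe : ⁅h, e⁆ = (2 : ℂ) • e) (hhf : ⁅h, f⁆ = (-2 : ℂ) • f) (he : e ≠ 0)
    (hspan : ∀ x : L, ∃ a b c : ℂ, x = a • e + b • f + c • h) : LieAlgebra.IsSimple ℂ L where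
  eq_bot_or_eq_top I := by
    have heh : ⁅e, h⁆ = (-2 : ℂ) • e := by rw [← lie_skew, hhe, neg_smul]
    have hfh : ⁅f, h⁆ = (2 : ℂ) • f := by rw [← lie_skew, hhf, neg_smul, neg_neg]
    have hfe : ⁅f, e⁆ = -h := by rw [← lie_skew, hef]
    have h2 : ∀ {c : ℂ} {x : L}, c ≠ 0 → c • x ∈ I → x ∈ I := by
      intro c x hc hx
      have := I.smul_mem c⁻¹ hx
      rwa [smul_smul, inv_mul_cancel₀ hc, one_smul] at this
    have key : h ∈ I → I = ⊤ := by
      intro hh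
      have e1 : e ∈ I := h2 (c := -2) (by norm_num) (heh ▸ lie_mem_right ℂ L I e h hh)
      have f1 : f ∈ I := h2 (c := 2) (by norm_num) (hfh ▸ lie_mem_right ℂ L I f h hh)
      rw [eq_top_iff]
      intro x _
      obtain ⟨a, b, c, rfl⟩ := hspan x
      exact add_mem (add_mem (I.smul_mem _ e1) (I.smul_mem _ f1)) (I.smul_mem _ hh)
    have keye : e ∈ I → I = ⊤ := by
      intro he'
      refine key (h2 (c := -1) (by norm_num) ?_)
      rw [neg_one_smul, ← hfe]
      exact lie_mem_right ℂ L I f e he'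
    have keyf : f ∈ I → I = ⊤ := fun hf' => key (hef ▸ lie_mem_right ℂ L I e f hf')
    by_cases hI : I = ⊥
    · exact Or.inl hI
    right
    rw [LieSubmodule.eq_bot_iff] at hI
    push Not at hI
    obtain ⟨x, hx, hx0⟩ := hI
    obtain ⟨a, b, c, rfl⟩ := hspan x
    have hee := lie_mem_right ℂ L I e _ (lie_mem_right ℂ L I e _ hx)
    have hff := lie_mem_right ℂ L I f _ (lie_mem_right ℂ L I f _ hx)
    simp only [lie_add, lie_smul, lie_self, hef, heh, hfe, hfh, lie_neg, smul_neg, smul_zero, zero_add,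
      add_zero, smul_smul] at hee hff
    by_cases hb : b = 0
    · by_cases ha : a = 0
      · subst ha hb
        simp only [zero_smul, zero_add] at hx hx0
        exact key (h2 (fun hc => hx0 (by rw [hc, zero_smul])) hx)
      · rw [← neg_smul] at hff
        exact keyf (h2 (neg_ne_zero.2 (mul_ne_zero ha two_ne_zero)) hff)
    · exact keye (h2 (mul_ne_zero hb (by norm_num)) hee)
  non_abelian hab := by
    have h0 : (2 : ℂ) • e = 0 := by rw [← hhe]; exact hab.trivial h e
    exact he ((smul_eq_zero.1 h0).resolve_left two_ne_zero)

theorem x₃_mem : x₃ ∈ A11 := mem_gen (by simp)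
theorem y₃_mem : y₃ ∈ A11 := mem_gen (by simp)
theorem h_mem : h₁ + h₂ ∈ A11 := mem_gen (by simp)

theorem eq_blockPart {X : A2} (h : X ∈ A11) : X = blockPart X := by
  obtain ⟨h1, h2, h3, h4, h5⟩ := (mem_A11 X).1 h
  apply A2_ext
  intro i j
  fin_cases i <;> fin_cases j <;>
    simp [blockPart, chevalley, x₃, y₃, h₁, h₂, h1, h2, h3, h4, h5, entry_two_two X]

theorem lie_x₃_y₃ : ⁅x₃, y₃⁆ = h₁ + h₂ := by
  apply A2_ext
  intro i j
  rw [lie_apply]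
  fin_cases i <;> fin_cases j <;> simp [chevalley, x₃, y₃, h₁, h₂]

theorem lie_h_x₃ : ⁅h₁ + h₂, x₃⁆ = (2 : ℂ) • x₃ := by
  apply A2_ext
  intro i j
  rw [lie_apply]
  fin_cases i <;> fin_cases j <;> simp [chevalley, x₃, h₁, h₂]; norm_num

theorem lie_h_y₃ : ⁅h₁ + h₂, y₃⁆ = (-2 : ℂ) • y₃ := by
  apply A2_ext
  intro i j
  rw [lie_apply]
  fin_cases i <;> fin_cases j <;> simp [chevalley, y₃, h₁, h₂]; norm_num

theorem x₃_ne_zero : x₃ ≠ 0 := by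
  intro h
  have := congrArg (fun X : A2 => X.val 0 2) h
  simp [x₃, chevalley] at this

theorem isSimple_A11 : LieAlgebra.IsSimple ℂ A11 := by
  refine isSimple_of_sl2_basis (e := (⟨x₃, x₃_mem⟩ : A11)) (f := ⟨y₃, y₃_mem⟩) (h := ⟨h₁ + h₂, h_mem⟩)
    (Subtype.ext lie_x₃_y₃) (Subtype.ext lie_h_x₃) (Subtype.ext lie_h_y₃)
    (fun h => x₃_ne_zero (congrArg Subtype.val h)) fun X => ⟨-X.val.val 0 2, -X.val.val 2 0,
      (X.val.val 0 0 - X.val.val 2 2) / 2, Subtype.ext (eq_blockPart X.2)⟩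

/-- The hypothesis `hsub` makes `blockPart` a projection along R, so the Lie algebra join is already
a sum of subspaces. -/
theorem isSemidirectSum_of_sub_blockPart {R : LieSubalgebra ℂ A2} (hinf : ∀ X ∈ A11, X ∈ R → X = 0)
    (hsub : ∀ X ∈ A11 ⊔ R, X - blockPart X ∈ R) (hideal : ∀ X ∈ A11 ⊔ R, ∀ Y ∈ R, ⁅X, Y⁆ ∈ R) :
    IsSemidirectSum A11 R (A11 ⊔ R) where
  inf_eq_bot := by
    rw [eq_bot_iff]
    rintro X ⟨h1, h2⟩
    exact hinf X h1 h2
  sup_eq := by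
    apply le_antisymm
    · exact sup_le (fun X hX => (le_sup_left : A11 ≤ A11 ⊔ R) hX)
        (fun X hX => (le_sup_right : R ≤ A11 ⊔ R) hX)
    · intro X hX
      exact (mem_sup_of_sub_blockPart (hsub X hX)).2
  ideal := hideal

theorem isDirectSum_levi0 : IsDirectSum A11 (gen {h₁ - h₂}) (leviSubalgebra 0) where
  toIsSemidirectSum := by
    refine isSemidirectSum_of_sub_blockPart ?_ ?_ ?_
    · intro X hX hX'
      rw [mem_A11] at hX
      rw [mem_rad0] at hX'
      rw [eq_chevalley X]
      have := trace_entries X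
      obtain ⟨h1, h2, h3, h4, h5⟩ := hX
      obtain ⟨-, -, -, -, h6, h7, h8⟩ := hX'
      have h9 : X.val 2 2 = 0 := by linear_combination (this - h5 - h8) / 2
      simp [h1, h2, h3, h4, h6, h7, h8, h9]
    · intro X hX
      obtain ⟨h1, h2, h3, h4⟩ := (mem_levi0 X).1 hX
      rw [mem_rad0]
      simp [blockPart, x₃, y₃, h₁, h₂, chevalley, h1, h2, h3, h4]
      ring
    · intro X hX Y hY
      obtain ⟨h1, h2, h3, h4⟩ := (mem_levi0 X).1 hX
      rw [mem_rad0] at hY ⊢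
      obtain ⟨k1, k2, k3, k4, k5, k6, k7⟩ := hY
      simp [lie_apply, h1, h2, h3, h4, k1, k2, k3, k4, k5, k6, k7, mul_comm]
  commute X hX Y hY := by
    rw [mem_A11] at hX
    rw [mem_rad0] at hY
    obtain ⟨h1, h2, h3, h4, h5⟩ := hX
    obtain ⟨k1, k2, k3, k4, k5, k6, k7⟩ := hY
    apply A2_ext
    intro i j
    rw [lie_apply]
    fin_cases i <;> fin_cases j <;>
      simp [h1, h2, h3, h4, h5, k1, k2, k3, k4, k5, k6, k7, mul_comm]

theorem isSemidirectSum_levi1 : IsSemidirectSum A11 (gen {x₁, y₂}) (leviSubalgebra 1) := by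
  refine isSemidirectSum_of_sub_blockPart ?_ ?_ ?_
  · intro X hX hX'
    rw [mem_A11] at hX
    rw [mem_rad1] at hX'
    rw [eq_chevalley X]
    obtain ⟨h1, h2, h3, h4, h5⟩ := hX
    obtain ⟨h6, h7, h8, -⟩ := hX'
    simp [h1, h2, h3, h4, h5, h6, h7, h8, entry_two_two X]
  · intro X hX
    obtain ⟨h1, h2, h3⟩ := (mem_levi1 X).1 hX
    rw [mem_rad1]
    simp [blockPart, x₃, y₃, h₁, h₂, chevalley, h1, h2, h3, entry_two_two X]
  · intro X hX Y hY
    obtain ⟨h1, h2, h3⟩ := (mem_levi1 X).1 hX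
    rw [mem_rad1] at hY ⊢
    obtain ⟨k1, k2, k3, k4, k5, k6⟩ := hY
    have k7 : Y.val 2 2 = 0 := by rw [entry_two_two, k1, k6]; ring
    simp [lie_apply, h1, h2, h3, k1, k2, k3, k4, k5, k6, k7]

theorem isSemidirectSum_levi2 : IsSemidirectSum A11 (gen {x₂, y₁}) (leviSubalgebra 2) := by
  refine isSemidirectSum_of_sub_blockPart ?_ ?_ ?_
  · intro X hX hX'
    rw [mem_A11] at hX
    rw [mem_rad2] at hX'
    rw [eq_chevalley X]
    obtain ⟨h1, h2, h3, h4, h5⟩ := hX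
    obtain ⟨h6, h7, h8, -⟩ := hX'
    simp [h1, h2, h3, h4, h5, h6, h7, h8, entry_two_two X]
  · intro X hX
    obtain ⟨h1, h2, h3⟩ := (mem_levi2 X).1 hX
    rw [mem_rad2]
    simp [blockPart, x₃, y₃, h₁, h₂, chevalley, h1, h2, h3, entry_two_two X]
  · intro X hX Y hY
    obtain ⟨h1, h2, h3⟩ := (mem_levi2 X).1 hX
    rw [mem_rad2] at hY ⊢
    obtain ⟨k1, k2, k3, k4, k5, k6⟩ := hY
    have k7 : Y.val 2 2 = 0 := by rw [entry_two_two, k1, k6]; ring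
    simp [lie_apply, h1, h2, h3, k1, k2, k3, k4, k5, k6, k7]

theorem isSemidirectSum_levi3 :
    IsSemidirectSum A11 (gen {h₁ - h₂, x₁, y₂}) (leviSubalgebra 3) := by
  refine isSemidirectSum_of_sub_blockPart ?_ ?_ ?_
  · intro X hX hX'
    rw [mem_A11] at hX
    rw [mem_rad3] at hX'
    rw [eq_chevalley X]
    have := trace_entries X
    obtain ⟨h1, h2, h3, h4, h5⟩ := hX
    obtain ⟨h6, h7, -, -, h8⟩ := hX'
    have h9 : X.val 2 2 = 0 := by linear_combination (this - h5 - h8) / 2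
    simp [h1, h2, h3, h4, h6, h7, h8, h9]
  · intro X hX
    obtain ⟨h1, h2⟩ := (mem_levi3 X).1 hX
    rw [mem_rad3]
    simp [blockPart, x₃, y₃, h₁, h₂, chevalley, h1, h2]
    ring
  · intro X hX Y hY
    obtain ⟨h1, h2⟩ := (mem_levi3 X).1 hX
    rw [mem_rad3] at hY ⊢
    obtain ⟨k1, k2, k3, k4, k5⟩ := hY
    simp [lie_apply, h1, h2, k1, k2, k3, k4, k5, mul_comm]

theorem isSemidirectSum_levi4 :
    IsSemidirectSum A11 (gen {h₁ - h₂, x₂, y₁}) (leviSubalgebra 4) := by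
  refine isSemidirectSum_of_sub_blockPart ?_ ?_ ?_
  · intro X hX hX'
    rw [mem_A11] at hX
    rw [mem_rad4] at hX'
    rw [eq_chevalley X]
    have := trace_entries X
    obtain ⟨h1, h2, h3, h4, h5⟩ := hX
    obtain ⟨h6, h7, -, -, h8⟩ := hX'
    have h9 : X.val 2 2 = 0 := by linear_combination (this - h5 - h8) / 2
    simp [h1, h2, h3, h4, h6, h7, h8, h9]
  · intro X hX
    obtain ⟨h1, h2⟩ := (mem_levi4 X).1 hX
    rw [mem_rad4]
    simp [blockPart, x₃, y₃, h₁, h₂, chevalley, h1, h2]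
    ring
  · intro X hX Y hY
    obtain ⟨h1, h2⟩ := (mem_levi4 X).1 hX
    rw [mem_rad4] at hY ⊢
    obtain ⟨k1, k2, k3, k4, k5⟩ := hY
    simp [lie_apply, h1, h2, k1, k2, k3, k4, k5, mul_comm]

theorem isSemidirectSum_levi (i : Fin 5) :
    IsSemidirectSum A11 (radicalPart i) (leviSubalgebra i) := by
  fin_cases i
  · exact isDirectSum_levi0.toIsSemidirectSum
  · exact isSemidirectSum_levi1
  · exact isSemidirectSum_levi2
  · exact isSemidirectSum_levi3
  · exact isSemidirectSum_levi4

/-- Brackets lose the component along h₁ - h₂ and land in the abelian algebra spanned by x₁ and y₂.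
-/
theorem lie_lie_lie_rad3 {X Y Z W : A2} (hX : X ∈ gen {h₁ - h₂, x₁, y₂})
    (hY : Y ∈ gen {h₁ - h₂, x₁, y₂}) (hZ : Z ∈ gen {h₁ - h₂, x₁, y₂})
    (hW : W ∈ gen {h₁ - h₂, x₁, y₂}) : ⁅⁅X, Y⁆, ⁅Z, W⁆⁆ = 0 := by
  have key : ∀ {X Y : A2}, X ∈ gen {h₁ - h₂, x₁, y₂} → Y ∈ gen {h₁ - h₂, x₁, y₂} →
      ⁅X, Y⁆ ∈ gen {x₁, y₂} := by
    intro X Y hX hY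
    rw [mem_rad3] at hX hY
    obtain ⟨h1, h2, h3, h4, h5⟩ := hX
    obtain ⟨k1, k2, k3, k4, k5⟩ := hY
    rw [mem_rad1]
    simp [lie_apply, h1, h2, h3, h4, h5, k1, k2, k3, k4, k5, mul_comm]
  obtain ⟨h1, h2, h3, h4, h5, h6⟩ := (mem_rad1 _).1 (key hX hY)
  obtain ⟨k1, k2, k3, k4, k5, k6⟩ := (mem_rad1 _).1 (key hZ hW)
  generalize (⁅X, Y⁆ : A2) = U at *
  generalize (⁅Z, W⁆ : A2) = V at *
  apply A2_ext
  intro i j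
  rw [lie_apply]
  fin_cases i <;> fin_cases j <;>
    simp [h1, h2, h3, h4, h5, h6, k1, k2, k3, k4, k5, k6, entry_two_two U, entry_two_two V]

theorem lie_mem_rad2_of_rad4 {X Y : A2} (hX : X ∈ gen {h₁ - h₂, x₂, y₁})
    (hY : Y ∈ gen {h₁ - h₂, x₂, y₁}) : ⁅X, Y⁆ ∈ gen {x₂, y₁} := by
  rw [mem_rad4] at hX hY
  obtain ⟨h1, h2, h3, h4, h5⟩ := hX
  obtain ⟨k1, k2, k3, k4, k5⟩ := hY
  rw [mem_rad2]
  simp [lie_apply, h1, h2, h3, h4, h5, k1, k2, k3, k4, k5, mul_comm]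

theorem lie_eq_zero_of_rad2 {X Y : A2} (hX : X ∈ gen {x₂, y₁}) (hY : Y ∈ gen {x₂, y₁}) :
    ⁅X, Y⁆ = 0 := by
  rw [mem_rad2] at hX hY
  obtain ⟨h1, h2, h3, h4, h5, h6⟩ := hX
  obtain ⟨k1, k2, k3, k4, k5, k6⟩ := hY
  apply A2_ext
  intro i j
  rw [lie_apply]
  fin_cases i <;> fin_cases j <;>
    simp [h1, h2, h3, h4, h5, h6, k1, k2, k3, k4, k5, k6, entry_two_two X, entry_two_two Y]

theorem lie_lie_lie_rad4 {X Y Z W : A2} (hX : X ∈ gen {h₁ - h₂, x₂, y₁})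
    (hY : Y ∈ gen {h₁ - h₂, x₂, y₁}) (hZ : Z ∈ gen {h₁ - h₂, x₂, y₁})
    (hW : W ∈ gen {h₁ - h₂, x₂, y₁}) : ⁅⁅X, Y⁆, ⁅Z, W⁆⁆ = 0 :=
  lie_eq_zero_of_rad2 (lie_mem_rad2_of_rad4 hX hY) (lie_mem_rad2_of_rad4 hZ hW)

/-- Reduces solvability of all five radicals to the two largest. -/
theorem radicalPart_le (i : Fin 5) :
    radicalPart i ≤ gen {h₁ - h₂, x₁, y₂} ∨ radicalPart i ≤ gen {h₁ - h₂, x₂, y₁} := by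
  fin_cases i
  · exact Or.inl (LieSubalgebra.lieSpan_mono (by simp))
  · exact Or.inl (LieSubalgebra.lieSpan_mono (by simp))
  · exact Or.inr (LieSubalgebra.lieSpan_mono (by simp))
  · exact Or.inl le_rfl
  · exact Or.inr le_rfl

theorem isSolvable_radicalPart (i : Fin 5) : LieAlgebra.IsSolvable (radicalPart i) := by
  apply isSolvable_of_lie_lie_lie_eq_zero
  intro X Y Z W
  apply Subtype.ext
  rcases radicalPart_le i with h | h
  · exact lie_lie_lie_rad3 (h X.2) (h Y.2) (h Z.2) (h W.2)
  · exact lie_lie_lie_rad4 (h X.2) (h Y.2) (h Z.2) (h W.2)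

theorem ne_bot_of_mem {L : LieSubalgebra ℂ A2} {X : A2} (h : X ∈ L) (i j : Fin 3)
    (h0 : X.val i j ≠ 0) : L ≠ ⊥ := by
  rintro rfl
  rw [LieSubalgebra.mem_bot] at h
  exact h0 (by simp [h])

theorem radicalPart_ne_bot (i : Fin 5) : radicalPart i ≠ ⊥ := by
  fin_cases i
  · exact ne_bot_of_mem (X := h₁ - h₂) (mem_gen (by simp)) 0 0 (by simp [h₁, h₂, chevalley])
  · exact ne_bot_of_mem (X := x₁) (mem_gen (by simp)) 0 1 (by simp [x₁, chevalley])
  · exact ne_bot_of_mem (X := x₂) (mem_gen (by simp)) 1 2 (by simp [x₂, chevalley])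
  · exact ne_bot_of_mem (X := x₁) (mem_gen (by simp)) 0 1 (by simp [x₁, chevalley])
  · exact ne_bot_of_mem (X := x₂) (mem_gen (by simp)) 1 2 (by simp [x₂, chevalley])

theorem isLeviDecomposable_levi (i : Fin 5) : IsLeviDecomposable (leviSubalgebra i) := by
  have := isSimple_A11
  exact ⟨A11, radicalPart i, ne_bot_of_mem x₃_mem 0 2 (by simp [x₃, chevalley]),
    radicalPart_ne_bot i, inferInstance, isSolvable_radicalPart i, isSemidirectSum_levi i⟩

/-! ### The isomorphism types -/

/-- The matrix `-Xᵀ` as an element of `A₂`. -/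
def negTr (X : A2) : A2 :=
  ⟨-X.val.transpose, mem_A2 (by
    rw [Matrix.trace_neg, Matrix.trace_transpose, neg_eq_zero]; exact X.property)⟩

theorem negTr_apply (X : A2) (i j : Fin 3) : (negTr X).val i j = -X.val j i := rfl

theorem negTr_negTr (X : A2) : negTr (negTr X) = X :=
  A2_ext fun i j => by rw [negTr_apply, negTr_apply, neg_neg]

/-- The automorphism `X ↦ -Xᵀ` of `A₂`. -/
def negTranspose : A2 ≃ₗ⁅ℂ⁆ A2 where
  toFun := negTr
  invFun := negTr
  map_add' X Y := A2_ext fun i j => by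
    change -(X.val j i + Y.val j i) = -X.val j i + -Y.val j i
    ring
  map_smul' c X := A2_ext fun i j => by
    change -(c * X.val j i) = c * -X.val j i
    ring
  map_lie' {X Y} := A2_ext fun i j => by
    rw [negTr_apply, lie_apply, lie_apply]
    simp only [negTr_apply]
    ring
  left_inv := negTr_negTr
  right_inv := negTr_negTr

theorem negTranspose_apply (X : A2) (i j : Fin 3) :
    (negTranspose X).val i j = -X.val j i := rfl

theorem negTranspose_negTranspose (X : A2) : negTranspose (negTranspose X) = X :=
  negTranspose.left_inv X

theorem mem_map_negTranspose {L : LieSubalgebra ℂ A2} {X : A2} :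
    X ∈ L.map negTranspose.toLieHom ↔ negTranspose X ∈ L := by
  constructor
  · rintro ⟨Y, hY, rfl⟩
    change negTranspose (negTranspose Y) ∈ L
    rwa [negTranspose_negTranspose]
  · intro h
    exact ⟨negTranspose X, h, negTranspose_negTranspose X⟩

/-- Transposition swaps conditions on the middle row with conditions on the middle column; this
lemma and the next four record the resulting permutation of the list. -/
theorem map_negTranspose_levi0 :
    (leviSubalgebra 0).map negTranspose.toLieHom = leviSubalgebra 0 := by
  ext X
  rw [mem_map_negTranspose, mem_levi0, mem_levi0]
  simp only [negTranspose_apply, neg_eq_zero]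
  tauto

theorem map_negTranspose_levi1 :
    (leviSubalgebra 1).map negTranspose.toLieHom = leviSubalgebra 2 := by
  ext X
  rw [mem_map_negTranspose, mem_levi1, mem_levi2]
  simp only [negTranspose_apply, neg_eq_zero]

theorem map_negTranspose_levi2 :
    (leviSubalgebra 2).map negTranspose.toLieHom = leviSubalgebra 1 := by
  ext X
  rw [mem_map_negTranspose, mem_levi1, mem_levi2]
  simp only [negTranspose_apply, neg_eq_zero]

theorem map_negTranspose_levi3 :
    (leviSubalgebra 3).map negTranspose.toLieHom = leviSubalgebra 4 := by
  ext X
  rw [mem_map_negTranspose, mem_levi3, mem_levi4]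
  simp only [negTranspose_apply, neg_eq_zero]

theorem map_negTranspose_levi4 :
    (leviSubalgebra 4).map negTranspose.toLieHom = leviSubalgebra 3 := by
  ext X
  rw [mem_map_negTranspose, mem_levi3, mem_levi4]
  simp only [negTranspose_apply, neg_eq_zero]

/-- A subalgebra is isomorphic to its preimage under an injective homomorphism onto it. -/
theorem nonempty_equiv_of_injective {K : Type*} [LieRing K] [LieAlgebra ℂ K]
    {L : LieSubalgebra ℂ A2} (f : K →ₗ⁅ℂ⁆ A2) (hf : Function.Injective f)
    (hL : ∀ X, X ∈ L ↔ ∃ k, f k = X) : Nonempty (L ≃ₗ⁅ℂ⁆ K) := by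
  have e : f.range = L := by
    ext X
    rw [hL, LieHom.mem_range]
  subst e
  exact ⟨(LieEquiv.ofInjective f hf).symm⟩

/-! ### Embeddings of the model algebras into `A2` -/

theorem entry_one_one (M : A1) : M.val 1 1 = -M.val 0 0 := by
  have h : Matrix.trace M.val = 0 := M.property
  rw [Matrix.trace_fin_two] at h
  linear_combination h

theorem A1_ext {M N : A1} (h0 : M.val 0 0 = N.val 0 0) (h1 : M.val 0 1 = N.val 0 1)
    (h2 : M.val 1 0 = N.val 1 0) : M = N := by
  apply Subtype.ext
  ext i j
  fin_cases i <;> fin_cases j <;> simp [h0, h1, h2, entry_one_one]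

/-- The matrix of `A₁` with given first row and lower left entry. -/
def mkA1 (a b c : ℂ) : A1 :=
  ⟨!![a, b; c, -a], LinearMap.mem_ker.2 (by simp [Matrix.trace_fin_two])⟩

theorem chi_val (M : A1) :
    (chi M).val = !![M.val 0 0, 0, -M.val 0 1; 0, 0, 0; -M.val 1 0, 0, -M.val 0 0] := by
  ext i j
  fin_cases i <;> fin_cases j <;> simp [chi, x₃, y₃, h₁, h₂, chevalley]

/-- `χ` as a homomorphism. -/
def chiHom : A1 →ₗ⁅ℂ⁆ A2 where
  toFun := chi
  map_add' M N := by
    apply A2_ext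
    intro i j
    fin_cases i <;> fin_cases j <;> simp [chi_val] <;> ring
  map_smul' c M := by
    apply A2_ext
    intro i j
    fin_cases i <;> fin_cases j <;> simp [chi_val]
  map_lie' {M N} := by
    apply A2_ext
    intro i j
    rw [lie_apply]
    have h3 : (⁅M, N⁆ : A1).val = M.val * N.val - N.val * M.val := by rw [sl_bracket]
    have h1 := entry_one_one M
    have h2 := entry_one_one N
    fin_cases i <;> fin_cases j <;>
      simp [chi_val, h3, Matrix.mul_apply, Fin.sum_univ_two, h1, h2] <;> ring

/-- The coordinates on `J`. -/
def J.coord : J ≃ₗ[ℂ] ℂ := LinearEquiv.refl ℂ ℂ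

/-- The coordinates on `K₁`. -/
def K1.coord : K1 ≃ₗ[ℂ] (Fin 2 → ℂ) := LinearEquiv.refl ℂ (Fin 2 → ℂ)

/-- The coordinates on `L₂`. -/
def L2.coord : L2 ≃ₗ[ℂ] (Fin 3 → ℂ) := LinearEquiv.refl ℂ (Fin 3 → ℂ)

theorem J.coord_lie (u v : J) : J.coord ⁅u, v⁆ = 0 := rfl
theorem K1.coord_lie (u v : K1) : K1.coord ⁅u, v⁆ = 0 := rfl
theorem L2.coord_lie (u v : L2) : L2.coord ⁅u, v⁆ = bracketL2 (L2.coord u) (L2.coord v) := rfl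

theorem chi_lie (M N : A1) : chi ⁅M, N⁆ = ⁅chi M, chi N⁆ := chiHom.map_lie M N

theorem psi1_val (u : K1) :
    (psi1 u).val = !![0, K1.coord u 0, 0; 0, 0, 0; 0, K1.coord u 1, 0] := by
  ext i j
  have h : ∀ k, K1.coord u k = (u : Fin 2 → ℂ) k := fun _ => rfl
  fin_cases i <;> fin_cases j <;> simp [psi1, x₁, y₂, chevalley, h]

/-- `ψ₁` as a homomorphism. -/
def psi1Hom : K1 →ₗ⁅ℂ⁆ A2 where
  toFun := psi1
  map_add' u v := by
    apply A2_ext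
    intro i j
    fin_cases i <;> fin_cases j <;> simp [psi1_val]
  map_smul' c u := by
    apply A2_ext
    intro i j
    fin_cases i <;> fin_cases j <;> simp [psi1_val]
  map_lie' {u v} := by
    apply A2_ext
    intro i j
    rw [lie_apply]
    fin_cases i <;> fin_cases j <;> simp [psi1_val, K1.coord_lie]

theorem psi2_val (u : L2) :
    (psi2 u).val = !![L2.coord u 2 / 3, L2.coord u 0, 0;
      0, -2 * L2.coord u 2 / 3, 0; 0, L2.coord u 1, L2.coord u 2 / 3] := by
  ext i j
  have h : ∀ k, L2.coord u k = (u : Fin 3 → ℂ) k := fun _ => rfl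
  fin_cases i <;> fin_cases j <;> simp [psi2, x₁, y₂, h₁, h₂, chevalley, h] <;> ring

/-- `ψ₂` as a homomorphism. -/
def psi2Hom : L2 →ₗ⁅ℂ⁆ A2 where
  toFun := psi2
  map_add' u v := by
    apply A2_ext
    intro i j
    fin_cases i <;> fin_cases j <;> simp [psi2_val] <;> ring
  map_smul' c u := by
    apply A2_ext
    intro i j
    fin_cases i <;> fin_cases j <;> simp [psi2_val] <;> ring
  map_lie' {u v} := by
    apply A2_ext
    intro i j
    rw [lie_apply]
    fin_cases i <;> fin_cases j <;> simp [psi2_val, bracketL2, L2.coord_lie] <;> ring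

/-- The homomorphism from a semidirect sum induced by compatible homomorphisms from its factors. -/
def semiDirectLift {K L g : Type*} [LieRing K] [LieAlgebra ℂ K] [LieRing L] [LieAlgebra ℂ L]
    [LieRing g] [LieAlgebra ℂ g] {φ : L →ₗ⁅ℂ⁆ LieDerivation ℂ K K} (p : K →ₗ⁅ℂ⁆ g) (q : L →ₗ⁅ℂ⁆ g)
    (h : ∀ M u, p (φ M u) = ⁅q M, p u⁆) : (K ⋊⁅φ⁆ L) →ₗ⁅ℂ⁆ g where
  toFun x := p x.left + q x.right
  map_add' x y := by
    simp only [SemiDirectSum.add_eq_mk, map_add]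
    abel
  map_smul' c x := by
    simp only [SemiDirectSum.smul_eq_mk, map_smul, smul_add, RingHom.id_apply]
  map_lie' {x y} := by
    simp only [SemiDirectSum.lie_eq_mk, map_add, map_sub, LieHom.map_lie, h, lie_add, add_lie]
    rw [← lie_skew (p x.left) (q y.right)]
    abel

theorem nonempty_levi1_equiv : Nonempty (leviSubalgebra 1 ≃ₗ⁅ℂ⁆ (K1 ⋊⁅phi1⁆ A1)) := by
  refine nonempty_equiv_of_injective (semiDirectLift (φ := phi1) psi1Hom chiHom psi1_phi1) ?_ ?_
  · rw [injective_iff_map_eq_zero]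
    rintro ⟨u, M⟩ h
    have e : ∀ i j, (psi1 u).val i j + (chi M).val i j = 0 := fun i j =>
      congrArg (fun X : A2 => X.val i j) h
    simp only [psi1_val, chi_val] at e
    have hM : M = 0 := A1_ext (by simpa using e 0 0) (by simpa using e 0 2) (by simpa using e 2 0)
    have hu : u = 0 := by
      apply K1.coord.injective
      ext i
      fin_cases i
      · simpa using e 0 1
      · simpa using e 2 1
    exact SemiDirectSum.ext hu hM
  · intro X
    rw [mem_levi1]
    constructor
    · rintro ⟨h1, h2, h3⟩
      refine ⟨⟨K1.coord.symm ![X.val 0 1, X.val 2 1], mkA1 (X.val 0 0) (-X.val 0 2) (-X.val 2 0)⟩, ?_⟩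
      apply A2_ext
      intro i j
      change (psi1 _).val i j + (chi _).val i j = _
      rw [psi1_val, chi_val]
      fin_cases i <;> fin_cases j <;> simp [mkA1, h1, h2, h3, entry_two_two X]
    · rintro ⟨⟨u, M⟩, rfl⟩
      change (psi1 _).val 1 0 + (chi _).val 1 0 = 0 ∧ (psi1 _).val 1 2 + (chi _).val 1 2 = 0 ∧
        (psi1 _).val 1 1 + (chi _).val 1 1 = 0
      simp [psi1_val, chi_val]

theorem nonempty_levi3_equiv : Nonempty (leviSubalgebra 3 ≃ₗ⁅ℂ⁆ (L2 ⋊⁅phi2⁆ A1)) := by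
  refine nonempty_equiv_of_injective (semiDirectLift (φ := phi2) psi2Hom chiHom psi2_phi2) ?_ ?_
  · rw [injective_iff_map_eq_zero]
    rintro ⟨u, M⟩ h
    have e : ∀ i j, (psi2 u).val i j + (chi M).val i j = 0 := fun i j =>
      congrArg (fun X : A2 => X.val i j) h
    simp only [psi2_val, chi_val] at e
    have h2 : L2.coord u 2 = 0 := by simpa using e 1 1
    have hM : M = 0 := A1_ext (by simpa [h2] using e 0 0) (by simpa using e 0 2)
      (by simpa using e 2 0)
    have hu : u = 0 := by
      apply L2.coord.injective
      ext i
      fin_cases i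
      · simpa using e 0 1
      · simpa using e 2 1
      · exact h2
    exact SemiDirectSum.ext hu hM
  · intro X
    rw [mem_levi3]
    constructor
    · rintro ⟨h1, h2⟩
      -- Since z₃ maps to diag(1/3, -2/3, 1/3) and `chi` contributes opposite corner entries, the
      -- two corners of X add up to 2/3 of the z₃-coordinate.
      refine ⟨⟨L2.coord.symm ![X.val 0 1, X.val 2 1, 3 / 2 * (X.val 0 0 + X.val 2 2)],
        mkA1 ((X.val 0 0 - X.val 2 2) / 2) (-X.val 0 2) (-X.val 2 0)⟩, ?_⟩
      apply A2_ext
      intro i j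
      change (psi2 _).val i j + (chi _).val i j = _
      rw [psi2_val, chi_val]
      fin_cases i <;> fin_cases j <;> simp [mkA1, h1, h2, entry_two_two X] <;> ring
    · rintro ⟨⟨u, M⟩, rfl⟩
      change (psi2 _).val 1 0 + (chi _).val 1 0 = 0 ∧ (psi2 _).val 1 2 + (chi _).val 1 2 = 0
      simp [psi2_val, chi_val]

/-- Transported through the outer automorphism: numbers 1 and 2 are isomorphic although no inner
automorphism relates them. -/
theorem nonempty_levi2_equiv : Nonempty (leviSubalgebra 2 ≃ₗ⁅ℂ⁆ (K1 ⋊⁅phi1⁆ A1)) := by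
  obtain ⟨e⟩ := nonempty_levi1_equiv
  have h := map_negTranspose_levi1
  rw [← h]
  exact ⟨(negTranspose.lieSubalgebraMap (leviSubalgebra 1)).symm.trans e⟩

theorem nonempty_levi4_equiv : Nonempty (leviSubalgebra 4 ≃ₗ⁅ℂ⁆ (L2 ⋊⁅phi2⁆ A1)) := by
  obtain ⟨e⟩ := nonempty_levi3_equiv
  have h := map_negTranspose_levi3
  rw [← h]
  exact ⟨(negTranspose.lieSubalgebraMap (leviSubalgebra 3)).symm.trans e⟩

/-- The map `A₁ ⊕ J → A₂`. -/
def chiProdFun (M : A1) (t : J) : A2 := chi M + J.coord t • (h₁ - h₂)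

theorem chiProdFun_val (M : A1) (t : J) : (chiProdFun M t).val =
    !![M.val 0 0 + J.coord t, 0, -M.val 0 1; 0, -2 * J.coord t, 0;
      -M.val 1 0, 0, -M.val 0 0 + J.coord t] := by
  have e : ∀ i j, (chiProdFun M t).val i j = (chi M).val i j + J.coord t * (h₁ - h₂ : A2).val i j :=
    fun i j => rfl
  ext i j
  rw [e, chi_val]
  fin_cases i <;> fin_cases j <;> simp [h₁, h₂, chevalley]; ring

/-- The embedding `A₁ ⊕ J → A₂`. -/
def chiProd : A1 × J →ₗ⁅ℂ⁆ A2 where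
  toFun x := chiProdFun x.1 x.2
  map_add' x y := by
    apply A2_ext
    intro i j
    fin_cases i <;> fin_cases j <;> simp [chiProdFun_val] <;> ring
  map_smul' c x := by
    apply A2_ext
    intro i j
    fin_cases i <;> fin_cases j <;> simp [chiProdFun_val] <;> ring
  map_lie' {x y} := by
    obtain ⟨M, t⟩ := x
    obtain ⟨N, u⟩ := y
    change chiProdFun ⁅M, N⁆ ⁅t, u⁆ = ⁅chiProdFun M t, chiProdFun N u⁆
    rw [chiProdFun, J.coord_lie, zero_smul, add_zero, chi_lie]
    apply A2_ext
    intro i j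
    rw [lie_apply, lie_apply]
    fin_cases i <;> fin_cases j <;> simp [chi_val, chiProdFun_val] <;> ring

theorem nonempty_levi0_equiv_prod : Nonempty (leviSubalgebra 0 ≃ₗ⁅ℂ⁆ A1 × J) := by
  refine nonempty_equiv_of_injective chiProd ?_ ?_
  · rw [injective_iff_map_eq_zero]
    rintro ⟨M, t⟩ h
    have e : ∀ i j, (chiProdFun M t).val i j = 0 := fun i j =>
      congrArg (fun X : A2 => X.val i j) h
    simp only [chiProdFun_val] at e
    have ht : J.coord t = 0 := by simpa using e 1 1
    have hM : M = 0 := A1_ext (by simpa [ht] using e 0 0) (by simpa using e 0 2)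
      (by simpa using e 2 0)
    exact Prod.ext hM (J.coord.injective (ht.trans (map_zero J.coord).symm))
  · intro X
    rw [mem_levi0]
    constructor
    · rintro ⟨h1, h2, h3, h4⟩
      -- As h₁ - h₂ = diag(1, -2, 1), the `J`-coordinate is the mean of the two corner entries, and
      -- half their difference is the 𝔰𝔩(2) part.
      refine ⟨⟨mkA1 ((X.val 0 0 - X.val 2 2) / 2) (-X.val 0 2) (-X.val 2 0),
        J.coord.symm ((X.val 0 0 + X.val 2 2) / 2)⟩, ?_⟩
      apply A2_ext
      intro i j
      change (chiProdFun _ _).val i j = _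
      rw [chiProdFun_val]
      fin_cases i <;> fin_cases j <;>
        simp [mkA1, h1, h2, h3, h4, entry_two_two X] <;> ring
    · rintro ⟨⟨M, t⟩, rfl⟩
      change (chiProdFun _ _).val 0 1 = 0 ∧ (chiProdFun _ _).val 2 1 = 0 ∧
        (chiProdFun _ _).val 1 0 = 0 ∧ (chiProdFun _ _).val 1 2 = 0
      simp [chiProdFun_val]

/-- The embedding `𝔤𝔩(2, ℂ) → A₂` extending `χ`, up to signs. -/
def glEmbedding : Matrix (Fin 2) (Fin 2) ℂ →ₗ⁅ℂ⁆ A2 where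
  toFun M := ⟨!![M 0 0, 0, M 0 1; 0, -M 0 0 - M 1 1, 0; M 1 0, 0, M 1 1],
    mem_A2 (by simp [Matrix.trace_fin_three]; ring)⟩
  map_add' M N := by
    apply A2_ext
    intro i j
    fin_cases i <;> fin_cases j <;> simp <;> ring
  map_smul' c M := by
    apply A2_ext
    intro i j
    fin_cases i <;> fin_cases j <;> simp <;> ring
  map_lie' {M N} := by
    apply A2_ext
    intro i j
    rw [lie_apply]
    fin_cases i <;> fin_cases j <;>
      simp [LieRing.of_associative_ring_bracket, Matrix.mul_apply, Fin.sum_univ_two] <;> ring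

theorem glEmbedding_val (M : Matrix (Fin 2) (Fin 2) ℂ) : (glEmbedding M).val =
    !![M 0 0, 0, M 0 1; 0, -M 0 0 - M 1 1, 0; M 1 0, 0, M 1 1] := rfl

theorem nonempty_levi0_equiv_matrix :
    Nonempty (leviSubalgebra 0 ≃ₗ⁅ℂ⁆ Matrix (Fin 2) (Fin 2) ℂ) := by
  refine nonempty_equiv_of_injective glEmbedding ?_ ?_
  · rw [injective_iff_map_eq_zero]
    intro M h
    have e : ∀ i j, (glEmbedding M).val i j = 0 := fun i j => by rw [h]; rfl
    simp only [glEmbedding_val] at e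
    ext i j
    fin_cases i <;> fin_cases j
    · simpa using e 0 0
    · simpa using e 0 2
    · simpa using e 2 0
    · simpa using e 2 2
  · intro X
    rw [mem_levi0]
    constructor
    · rintro ⟨h1, h2, h3, h4⟩
      refine ⟨!![X.val 0 0, X.val 0 2; X.val 2 0, X.val 2 2], ?_⟩
      apply A2_ext
      intro i j
      rw [glEmbedding_val]
      fin_cases i <;> fin_cases j <;> simp [h1, h2, h3, h4, entry_two_two X]
    · rintro ⟨M, rfl⟩
      simp [glEmbedding_val]

/-! ### Dimensions of the five subalgebras -/

theorem finrank_A1 : Module.finrank ℂ A1 = 3 := by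
  let e : A1 ≃ₗ[ℂ] (Fin 3 → ℂ) :=
    { toFun := fun M => ![M.val 0 0, M.val 0 1, M.val 1 0]
      map_add' := fun M N => by ext i; fin_cases i <;> simp
      map_smul' := fun c M => by ext i; fin_cases i <;> simp
      invFun := fun u => mkA1 (u 0) (u 1) (u 2)
      left_inv := fun M => A1_ext (by simp [mkA1]) (by simp [mkA1]) (by simp [mkA1])
      right_inv := fun u => by ext i; fin_cases i <;> simp [mkA1] }
  rw [e.finrank_eq, Module.finrank_fin_fun]

instance : Module.Finite ℂ K1 := inferInstanceAs (Module.Finite ℂ (Fin 2 → ℂ))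
instance : Module.Finite ℂ L2 := inferInstanceAs (Module.Finite ℂ (Fin 3 → ℂ))

theorem finrank_K1 : Module.finrank ℂ K1 = 2 := Module.finrank_fin_fun ℂ
theorem finrank_L2 : Module.finrank ℂ L2 = 3 := Module.finrank_fin_fun ℂ

theorem finrank_levi0 : Module.finrank ℂ (leviSubalgebra 0) = 4 := by
  obtain ⟨e⟩ := nonempty_levi0_equiv_matrix
  rw [e.toLinearEquiv.finrank_eq, Module.finrank_matrix]
  simp

theorem finrank_levi1 : Module.finrank ℂ (leviSubalgebra 1) = 5 := by
  obtain ⟨e⟩ := nonempty_levi1_equiv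
  rw [e.toLinearEquiv.finrank_eq, (SemiDirectSum.toProdl phi1).finrank_eq, Module.finrank_prod,
    finrank_K1, finrank_A1]

theorem finrank_levi2 : Module.finrank ℂ (leviSubalgebra 2) = 5 := by
  obtain ⟨e⟩ := nonempty_levi2_equiv
  rw [e.toLinearEquiv.finrank_eq, (SemiDirectSum.toProdl phi1).finrank_eq, Module.finrank_prod,
    finrank_K1, finrank_A1]

theorem finrank_levi3 : Module.finrank ℂ (leviSubalgebra 3) = 6 := by
  obtain ⟨e⟩ := nonempty_levi3_equiv
  rw [e.toLinearEquiv.finrank_eq, (SemiDirectSum.toProdl phi2).finrank_eq, Module.finrank_prod,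
    finrank_L2, finrank_A1]

theorem finrank_levi4 : Module.finrank ℂ (leviSubalgebra 4) = 6 := by
  obtain ⟨e⟩ := nonempty_levi4_equiv
  rw [e.toLinearEquiv.finrank_eq, (SemiDirectSum.toProdl phi2).finrank_eq, Module.finrank_prod,
    finrank_L2, finrank_A1]

/-! ### Invariant lines -/

/-- `L` leaves a line of `ℂ³` invariant. -/
def HasInvariantLine (L : LieSubalgebra ℂ A2) : Prop :=
  ∃ v : Fin 3 → ℂ, v ≠ 0 ∧ ∀ X ∈ L, ∃ c : ℂ, X.val.mulVec v = c • v

theorem HasInvariantLine.mono {L L' : LieSubalgebra ℂ A2} (h : L ≤ L') (h' : HasInvariantLine L') :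
    HasInvariantLine L := by
  obtain ⟨v, hv, h'⟩ := h'
  exact ⟨v, hv, fun X hX => h' X (h hX)⟩

open LieModule in
/-- A solvable ideal acts by a character on a nonzero submodule (**Lie's theorem**). -/
theorem exists_lieSubmodule_of_isSolvable {L V : Type*} [LieRing L] [LieAlgebra ℂ L]
    [AddCommGroup V] [Module ℂ V] [FiniteDimensional ℂ V] [Nontrivial V] [LieRingModule L V]
    [LieModule ℂ L V] (I : LieIdeal ℂ L) [LieAlgebra.IsSolvable I] :
    ∃ (χ : I → ℂ) (W : LieSubmodule ℂ L V), W ≠ ⊥ ∧ ∀ v ∈ W, ∀ x : I, ⁅(x : L), v⁆ = χ x • v := by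
  obtain ⟨χ, hχ⟩ := exists_nontrivial_weightSpace_of_isSolvable ℂ I V
  -- The key point in Lie's theorem: in characteristic zero a weight space of an ideal is stable
  -- under the whole algebra.
  refine ⟨χ, weightSpaceOfIsLieTower ℂ V χ, ?_, ?_⟩
  · intro h
    obtain ⟨⟨v, hv⟩, hv0⟩ := exists_ne (0 : weightSpace V χ)
    have hv' : v ∈ weightSpaceOfIsLieTower (L := L) ℂ V χ := hv
    rw [h, LieSubmodule.mem_bot] at hv'
    exact hv0 (Subtype.ext hv')
  · intro v hv x
    have hv' : v ∈ weightSpace V χ := hv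
    rw [mem_weightSpace] at hv'
    exact hv' x

/-- The action of a subalgebra of `A₂` on `ℂ³`. -/
def toEndVec (L : LieSubalgebra ℂ A2) : L →ₗ⁅ℂ⁆ Module.End ℂ (Fin 3 → ℂ) :=
  (lieEquivMatrix' (R := ℂ) (n := Fin 3)).symm.toLieHom.comp
    ((LieSubalgebra.incl (sl (Fin 3) ℂ)).comp L.incl)

/-- The subspace is a weight space of R in ℂ³. Were it everything, each element of R would be scalar
and traceless, hence zero. -/
theorem exists_invariant_submodule {R L : LieSubalgebra ℂ A2} (hR : R ≠ ⊥)
    (hsol : LieAlgebra.IsSolvable R) (hRL : R ≤ L) (hideal : ∀ X ∈ L, ∀ Y ∈ R, ⁅X, Y⁆ ∈ R) :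
    ∃ W : Submodule ℂ (Fin 3 → ℂ), W ≠ ⊥ ∧ W ≠ ⊤ ∧ ∀ X ∈ L, ∀ v ∈ W, X.val.mulVec v ∈ W := by
  let : LieRingModule L (Fin 3 → ℂ) := LieRingModule.compLieHom (Fin 3 → ℂ) (toEndVec L)
  let : LieModule ℂ L (Fin 3 → ℂ) := LieModule.compLieHom (Fin 3 → ℂ) (toEndVec L)
  let I : LieIdeal ℂ L :=
    { carrier := {X | X.val ∈ R}
      zero_mem' := R.zero_mem
      add_mem' := fun hX hY => R.add_mem hX hY
      smul_mem' := fun c _ hX => R.smul_mem c hX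
      lie_mem := fun {X Y} hY => hideal X.1 X.2 Y.1 hY }
  let f : I →ₗ⁅ℂ⁆ R :=
    { toFun := fun X => ⟨X.1.1, X.2⟩
      map_add' := fun _ _ => rfl
      map_smul' := fun _ _ => rfl
      map_lie' := rfl }
  have hf : Function.Injective f := by
    intro X Y h
    exact Subtype.ext (Subtype.ext (congrArg (fun Z : R => Z.val) h))
  have : LieAlgebra.IsSolvable I := hf.lieAlgebra_isSolvable
  obtain ⟨χ, W, hW, hχ⟩ := exists_lieSubmodule_of_isSolvable (V := Fin 3 → ℂ) I
  refine ⟨W.toSubmodule, ?_, ?_, ?_⟩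
  · rwa [Ne, LieSubmodule.toSubmodule_eq_bot]
  · intro htop
    apply hR
    rw [LieSubalgebra.eq_bot_iff]
    intro X hX
    have h1 : ∀ v, X.val.mulVec v = χ ⟨⟨X, hRL hX⟩, hX⟩ • v := by
      intro v
      have hv : v ∈ W := by
        rw [← LieSubmodule.mem_toSubmodule, htop]
        trivial
      exact hχ v hv ⟨⟨X, hRL hX⟩, hX⟩
    generalize χ ⟨⟨X, hRL hX⟩, hX⟩ = c at h1
    have h2 : ∀ i j, X.val i j = c * (Pi.single j 1 : Fin 3 → ℂ) i := by
      intro i j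
      have := congrFun (h1 (Pi.single j 1)) i
      simpa using this
    have h3 := trace_entries X
    simp [h2] at h3
    have hc : c = 0 := by linear_combination h3 / 3
    apply A2_ext
    intro i j
    rw [h2, hc, zero_mul]
    rfl
  · intro X hX v hv
    exact W.lie_mem (x := ⟨X, hX⟩) hv

/-- An invariant plane is the kernel of a functional f, and the coordinate vector of f then spans an
invariant line for the dual action X ↦ -Xᵀ. -/
theorem hasInvariantLine_of_invariant_submodule {L : LieSubalgebra ℂ A2}
    {W : Submodule ℂ (Fin 3 → ℂ)} (h0 : W ≠ ⊥) (h1 : W ≠ ⊤)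
    (hW : ∀ X ∈ L, ∀ v ∈ W, X.val.mulVec v ∈ W) :
    HasInvariantLine L ∨ HasInvariantLine (L.map negTranspose.toLieHom) := by
  have hlt := Submodule.finrank_lt h1
  rw [Module.finrank_fin_fun] at hlt
  have hpos : 0 < Module.finrank ℂ W := Submodule.one_le_finrank_iff.2 h0
  have hcases : Module.finrank ℂ W = 1 ∨ Module.finrank ℂ W = 2 := by omega
  rcases hcases with h | h
  · left
    obtain ⟨⟨v, hv⟩, hv0, hspan⟩ := finrank_eq_one_iff'.1 h
    refine ⟨v, fun h => hv0 (Subtype.ext h), fun X hX => ?_⟩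
    obtain ⟨c, hc⟩ := hspan ⟨_, hW X hX v hv⟩
    exact ⟨c, (congrArg Subtype.val hc).symm⟩
  · right
    obtain ⟨f, hf, hWf⟩ := Submodule.exists_le_ker_of_lt_top W (lt_top_iff_ne_top.2 h1)
    have hrk := LinearMap.finrank_range_add_finrank_ker f
    have hr : LinearMap.range f = ⊤ := LinearMap.range_eq_top.2 (LinearMap.surjective hf)
    rw [hr, finrank_top, Module.finrank_self, Module.finrank_fin_fun] at hrk
    have hker : W = LinearMap.ker f :=
      Submodule.eq_of_le_of_finrank_eq hWf (by omega)
    obtain ⟨v₀, hv₀⟩ : ∃ v₀, f v₀ = 1 := LinearMap.surjective hf 1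
    have hu : ∀ w : Fin 3 → ℂ, f w = ∑ i, w i * f (Pi.single i 1) := by
      intro w
      conv_lhs => rw [pi_eq_sum_univ' w]
      rw [map_sum]
      refine Finset.sum_congr rfl fun i _ => ?_
      rw [map_smul, smul_eq_mul]
    refine ⟨fun i => f (Pi.single i 1), ?_, ?_⟩
    · intro hz
      apply hf
      ext i
      simpa using congrFun hz i
    · intro Y hY
      rw [mem_map_negTranspose] at hY
      -- With Z = -Yᵀ preserving ker f and f v₀ = 1, one has f ∘ Z = f(Z v₀) f; passing from Z to
      -- -Zᵀ changes the sign of the eigenvalue. The identity is tested on each basis vector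
      -- corrected by a multiple of v₀ so as to lie in ker f.
      refine ⟨-f ((negTranspose Y).val.mulVec v₀), ?_⟩
      ext j
      have h2 : Pi.single j 1 - f (Pi.single j 1) • v₀ ∈ W := by
        rw [hker, LinearMap.mem_ker, map_sub, map_smul, hv₀, smul_eq_mul, mul_one, sub_self]
      have h3 := hW _ hY _ h2
      rw [hker, LinearMap.mem_ker, Matrix.mulVec_sub, Matrix.mulVec_smul, map_sub, map_smul,
        sub_eq_zero, hu] at h3
      simp only [Matrix.mulVec_single_one, Matrix.col_apply, negTranspose_apply, neg_mul,
        Finset.sum_neg_distrib, smul_eq_mul] at h3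
      simp only [Matrix.mulVec, dotProduct, Pi.smul_apply, smul_eq_mul]
      linear_combination -h3

/-! ### Conjugation -/

theorem innerAut_spec (A : Matrix.SpecialLinearGroup (Fin 3) ℂ) (X : A2) :
    A.val * (innerAut A X).val = X.val * A.val := by
  change A.val * ((A⁻¹).val * X.val * A.val) = _
  have hA : A.val * (A⁻¹).val = 1 := by
    rw [← Matrix.SpecialLinearGroup.coe_mul, mul_inv_cancel, Matrix.SpecialLinearGroup.coe_one]
  rw [mul_assoc, ← mul_assoc, hA, one_mul]

theorem mul_left_cancel_SL (A : Matrix.SpecialLinearGroup (Fin 3) ℂ)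
    {X Y : Matrix (Fin 3) (Fin 3) ℂ} (h : A.val * X = A.val * Y) : X = Y := by
  have hA : (A⁻¹).val * A.val = 1 := by
    rw [← Matrix.SpecialLinearGroup.coe_mul, inv_mul_cancel, Matrix.SpecialLinearGroup.coe_one]
  have := congrArg (fun Z => (A⁻¹).val * Z) h
  simpa only [← mul_assoc, hA, one_mul] using this

theorem innerAut_eq {A : Matrix.SpecialLinearGroup (Fin 3) ℂ} {X Y : A2}
    (h : A.val * Y.val = X.val * A.val) : innerAut A X = Y :=
  Subtype.ext (mul_left_cancel_SL A ((innerAut_spec A X).trans h.symm))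

theorem innerAut_mul (A B : Matrix.SpecialLinearGroup (Fin 3) ℂ) (X : A2) :
    innerAut (A * B) X = innerAut B (innerAut A X) := by
  apply innerAut_eq
  rw [Matrix.SpecialLinearGroup.coe_mul, mul_assoc, innerAut_spec, ← mul_assoc, innerAut_spec,
    mul_assoc]

theorem innerAut_one (X : A2) : innerAut 1 X = X := innerAut_eq (by simp)

theorem mulVec_innerAut {A : Matrix.SpecialLinearGroup (Fin 3) ℂ} {X : A2} {v : Fin 3 → ℂ} {c : ℂ}
    (h : X.val.mulVec (A.val.mulVec v) = c • A.val.mulVec v) :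
    (innerAut A X).val.mulVec v = c • v := by
  have hA : (A⁻¹).val * A.val = 1 := by
    rw [← Matrix.SpecialLinearGroup.coe_mul, inv_mul_cancel, Matrix.SpecialLinearGroup.coe_one]
  change ((A⁻¹).val * X.val * A.val).mulVec v = c • v
  rw [← Matrix.mulVec_mulVec, ← Matrix.mulVec_mulVec, h, Matrix.mulVec_smul, Matrix.mulVec_mulVec,
    hA, Matrix.one_mulVec]

theorem Equivalent.trans {L L' L'' : LieSubalgebra ℂ A2} (h : Equivalent L L')
    (h' : Equivalent L' L'') : Equivalent L L'' := by
  obtain ⟨A, rfl⟩ := h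
  obtain ⟨B, rfl⟩ := h'
  refine ⟨A * B, ?_⟩
  ext X
  constructor
  · rintro ⟨Y, hY, rfl⟩
    exact ⟨innerAut A Y, ⟨Y, hY, rfl⟩, (innerAut_mul A B Y).symm⟩
  · rintro ⟨_, ⟨Y, hY, rfl⟩, rfl⟩
    exact ⟨Y, hY, innerAut_mul A B Y⟩

theorem Equivalent.symm {L L' : LieSubalgebra ℂ A2} (h : Equivalent L L') : Equivalent L' L := by
  obtain ⟨A, rfl⟩ := h
  refine ⟨A⁻¹, ?_⟩
  have h1 : ∀ Y, innerAut A⁻¹ (innerAut A Y) = Y := fun Y => by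
    rw [← innerAut_mul, mul_inv_cancel, innerAut_one]
  ext X
  constructor
  · rintro ⟨_, ⟨Y, hY, rfl⟩, rfl⟩
    change innerAut A⁻¹ (innerAut A Y) ∈ L
    rwa [h1]
  · intro hX
    exact ⟨innerAut A X, ⟨X, hX, rfl⟩, h1 X⟩

theorem Equivalent.hasInvariantLine {L L' : LieSubalgebra ℂ A2} (h : Equivalent L L')
    (hL : HasInvariantLine L) : HasInvariantLine L' := by
  obtain ⟨A, rfl⟩ := h
  obtain ⟨v, hv, hL⟩ := hL
  have hA : A.val * (A⁻¹).val = 1 := by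
    rw [← Matrix.SpecialLinearGroup.coe_mul, mul_inv_cancel, Matrix.SpecialLinearGroup.coe_one]
  have hAv : A.val.mulVec ((A⁻¹).val.mulVec v) = v := by
    rw [Matrix.mulVec_mulVec, hA, Matrix.one_mulVec]
  refine ⟨(A⁻¹).val.mulVec v, ?_, ?_⟩
  · intro h0
    rw [h0, Matrix.mulVec_zero] at hAv
    exact hv hAv.symm
  · rintro _ ⟨X, hX, rfl⟩
    obtain ⟨c, hc⟩ := hL X hX
    exact ⟨c, mulVec_innerAut (by rw [hAv, hc])⟩

theorem Equivalent.finrank_eq {L L' : LieSubalgebra ℂ A2} (h : Equivalent L L') :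
    Module.finrank ℂ L = Module.finrank ℂ L' := by
  obtain ⟨A, rfl⟩ := h
  exact ((innerAut A).lieSubalgebraMap L).toLinearEquiv.finrank_eq

/-- Transposing A⁻¹ (-Xᵀ) A and negating gives Aᵀ X A⁻ᵀ, which is conjugation by the inverse
transpose. -/
theorem negTranspose_innerAut (A : Matrix.SpecialLinearGroup (Fin 3) ℂ) (X : A2) :
    innerAut (A⁻¹).transpose X = negTranspose (innerAut A (negTranspose X)) := by
  apply innerAut_eq
  have h := innerAut_spec A (negTranspose X)
  generalize innerAut A (negTranspose X) = Z at h
  have h1 : (A⁻¹).val * A.val = 1 := by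
    rw [← Matrix.SpecialLinearGroup.coe_mul, inv_mul_cancel, Matrix.SpecialLinearGroup.coe_one]
  have h2 : A.val * (A⁻¹).val = 1 := by
    rw [← Matrix.SpecialLinearGroup.coe_mul, mul_inv_cancel, Matrix.SpecialLinearGroup.coe_one]
  have h3 : Z.val * (A⁻¹).val = (A⁻¹).val * (negTranspose X).val := by
    apply mul_left_cancel_SL A
    rw [← mul_assoc, h, mul_assoc, h2, ← mul_assoc, h2, mul_one, one_mul]
  have hX : (negTranspose X).val = -X.val.transpose := rfl
  have hZ : (negTranspose Z).val = -Z.val.transpose := rfl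
  have h4 := congrArg Matrix.transpose h3
  rw [hX, Matrix.transpose_mul, Matrix.transpose_mul, Matrix.transpose_neg,
    Matrix.transpose_transpose] at h4
  rw [hZ, Matrix.SpecialLinearGroup.coe_transpose, mul_neg, h4, neg_mul, neg_neg]

/-- Carries a classification of the dual of L back to L, which settles the case of an invariant
plane. -/
theorem Equivalent.of_map_negTranspose {L L' : LieSubalgebra ℂ A2}
    (h : Equivalent (L.map negTranspose.toLieHom) L') :
    Equivalent L (L'.map negTranspose.toLieHom) := by
  obtain ⟨A, rfl⟩ := h
  refine ⟨(A⁻¹).transpose, ?_⟩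
  ext X
  constructor
  · rintro ⟨Y, hY, rfl⟩
    exact ⟨innerAut A (negTranspose Y), ⟨negTranspose Y, ⟨Y, hY, rfl⟩, rfl⟩,
      (negTranspose_innerAut A Y).symm⟩
  · rintro ⟨_, ⟨_, ⟨Y, hY, rfl⟩, rfl⟩, rfl⟩
    exact ⟨Y, hY, negTranspose_innerAut A Y⟩

/-- `SL(3, ℂ)` moves the middle basis vector to any nonzero vector. -/
theorem exists_SL_mulVec_eq {v : Fin 3 → ℂ} (hv : v ≠ 0) :
    ∃ A : Matrix.SpecialLinearGroup (Fin 3) ℂ, A.val.mulVec ![0, 1, 0] = v := by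
  have e : ∀ M : Matrix (Fin 3) (Fin 3) ℂ, (∀ i, M i 1 = v i) → M.mulVec ![0, 1, 0] = v := by
    intro M h
    ext i
    simp [Matrix.mulVec, dotProduct, Fin.sum_univ_three, h]
  -- In each case v is the middle column, and an entry ±1 / v k for a nonzero coordinate v k
  -- normalises the determinant to 1.
  by_cases h1 : v 1 = 0
  · by_cases h0 : v 0 = 0
    · have h2 : v 2 ≠ 0 := by
        intro h2
        apply hv
        ext i
        fin_cases i
        · exact h0
        · exact h1
        · exact h2
      refine ⟨⟨!![1, v 0, 0; 0, v 1, -1 / v 2; 0, v 2, 0], ?_⟩, e _ ?_⟩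
      · simp [Matrix.det_fin_three]
        field_simp
      · intro i
        fin_cases i <;> simp
    · refine ⟨⟨!![0, v 0, 0; -1 / v 0, v 1, 0; 0, v 2, 1], ?_⟩, e _ ?_⟩
      · simp [Matrix.det_fin_three]
        field_simp
      · intro i
        fin_cases i <;> simp
  · refine ⟨⟨!![1 / v 1, v 0, 0; 0, v 1, 0; 0, v 2, 1], ?_⟩, e _ ?_⟩
    · simp [Matrix.det_fin_three]
      field_simp
    · intro i
      fin_cases i <;> simp

theorem mem_levi4_iff_mulVec {X : A2} :
    X ∈ leviSubalgebra 4 ↔ ∃ c : ℂ, X.val.mulVec ![0, 1, 0] = c • ![0, 1, 0] := by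
  rw [mem_levi4]
  constructor
  · rintro ⟨h1, h2⟩
    refine ⟨X.val 1 1, ?_⟩
    ext i
    fin_cases i <;> simp [Matrix.mulVec, dotProduct, Fin.sum_univ_three, h1, h2]
  · rintro ⟨c, hc⟩
    have h0 := congrFun hc 0
    have h2 := congrFun hc 2
    simp [Matrix.mulVec, dotProduct, Fin.sum_univ_three] at h0 h2
    exact ⟨h0, h2⟩

/-! ### Distinguishing the five subalgebras -/

theorem hasInvariantLine_levi4 : HasInvariantLine (leviSubalgebra 4) :=
  ⟨![0, 1, 0], fun h => by simpa using congrFun h 1, fun _ hX => mem_levi4_iff_mulVec.1 hX⟩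

theorem levi2_le_levi4 : leviSubalgebra 2 ≤ leviSubalgebra 4 := fun X hX => by
  rw [mem_levi2] at hX
  exact (mem_levi4 X).2 ⟨hX.1, hX.2.1⟩

theorem levi1_le_levi3 : leviSubalgebra 1 ≤ leviSubalgebra 3 := fun X hX => by
  rw [mem_levi1] at hX
  exact (mem_levi3 X).2 ⟨hX.1, hX.2.1⟩

theorem entry_mulVec_eq {X : A2} {v : Fin 3 → ℂ} {c : ℂ} (h : X.val.mulVec v = c • v)
    (i : Fin 3) : X.val i 0 * v 0 + X.val i 1 * v 1 + X.val i 2 * v 2 = c * v i := by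
  have := congrFun h i
  simpa [Matrix.mulVec, dotProduct, Fin.sum_univ_three] using this

/-- The nilpotents x₃ and y₃ can only have eigenvalue 0, which forces v 2 = 0 and v 0 = 0; then x₁
forces v 1 = 0. -/
theorem not_hasInvariantLine_levi1 : ¬ HasInvariantLine (leviSubalgebra 1) := by
  rintro ⟨v, hv, h⟩
  obtain ⟨c1, h1⟩ := h x₁ ((mem_levi1 _).2 (by simp [x₁, chevalley]))
  obtain ⟨c2, h2⟩ := h x₃ ((mem_levi1 _).2 (by simp [x₃, chevalley]))
  obtain ⟨c3, h3⟩ := h y₃ ((mem_levi1 _).2 (by simp [y₃, chevalley]))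
  have a0 := entry_mulVec_eq h1 0
  have a1 := entry_mulVec_eq h1 1
  have b0 := entry_mulVec_eq h2 0
  have b2 := entry_mulVec_eq h2 2
  have d0 := entry_mulVec_eq h3 0
  have d2 := entry_mulVec_eq h3 2
  simp [x₁, x₃, y₃, chevalley] at a0 a1 b0 b2 d0 d2
  apply hv
  ext i
  fin_cases i
  · simp; grind
  · simp; grind
  · simp; grind

theorem finrank_levi (i : Fin 5) : Module.finrank ℂ (leviSubalgebra i) = ![4, 5, 5, 6, 6] i := by
  fin_cases i
  · exact finrank_levi0
  · exact finrank_levi1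
  · exact finrank_levi2
  · exact finrank_levi3
  · exact finrank_levi4

theorem eq_of_equivalent_levi (i j : Fin 5)
    (h : Equivalent (leviSubalgebra i) (leviSubalgebra j)) : i = j := by
  have hd := h.finrank_eq
  rw [finrank_levi, finrank_levi] at hd
  have h2 := hasInvariantLine_levi4.mono levi2_le_levi4
  have h3 : ¬ HasInvariantLine (leviSubalgebra 3) := fun h =>
    not_hasInvariantLine_levi1 (h.mono levi1_le_levi3)
  have hl := h.hasInvariantLine
  have hr := h.symm.hasInvariantLine
  -- Dimension leaves only the pairs 1, 2 and 3, 4 in either order; in each, exactly one member has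
  -- an invariant line.
  fin_cases i <;> fin_cases j <;> first | rfl | (simp at hd; done) | skip
  · exact absurd (hr h2) not_hasInvariantLine_levi1
  · exact absurd (hl h2) not_hasInvariantLine_levi1
  · exact absurd (hr hasInvariantLine_levi4) h3
  · exact absurd (hl hasInvariantLine_levi4) h3

/-! ### The principal subalgebra is irreducible -/

/-- x₁ + x₂ is a single nilpotent Jordan block, whose only eigenline is spanned by the first basis
vector, and y₁ + y₂ moves that line. -/
theorem not_hasInvariantLine_A12 : ¬ HasInvariantLine A12 := by
  rintro ⟨v, hv, h⟩
  obtain ⟨c, h1⟩ := h (x₁ + x₂) (mem_gen (by simp))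
  obtain ⟨d, h2⟩ := h ((2 : ℂ) • y₁ + (2 : ℂ) • y₂) (mem_gen (by simp))
  have a := entry_mulVec_eq h1
  have b := entry_mulVec_eq h2
  have a0 := a 0
  have a1 := a 1
  have a2 := a 2
  have b0 := b 0
  have b1 := b 1
  have b2 := b 2
  simp [x₁, x₂, y₁, y₂, chevalley] at a0 a1 a2 b0 b1 b2
  clear h h1 h2 a b
  have hz : v 0 = 0 ∧ v 1 = 0 ∧ v 2 = 0 := by
    rcases a2 with rfl | ha
    · simp_all
    · have hb : v 1 = 0 := by simpa [ha] using b2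
      simp_all
  apply hv
  ext i
  fin_cases i
  · exact hz.1
  · exact hz.2.1
  · exact hz.2.2

theorem not_hasInvariantLine_map_A12 : ¬ HasInvariantLine (A12.map negTranspose.toLieHom) := by
  rintro ⟨v, hv, h⟩
  obtain ⟨c, h1⟩ := h (negTranspose (x₁ + x₂)) ⟨_, mem_gen (by simp), rfl⟩
  obtain ⟨d, h2⟩ := h (negTranspose ((2 : ℂ) • y₁ + (2 : ℂ) • y₂)) ⟨_, mem_gen (by simp), rfl⟩
  have a := entry_mulVec_eq h1
  have b := entry_mulVec_eq h2
  simp only [negTranspose_apply] at a b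
  have a0 := a 0
  have a1 := a 1
  have a2 := a 2
  have b0 := b 0
  have b1 := b 1
  have b2 := b 2
  simp [x₁, x₂, y₁, y₂, chevalley] at a0 a1 a2 b0 b1 b2
  clear h h1 h2 a b
  have hz : v 0 = 0 ∧ v 1 = 0 ∧ v 2 = 0 := by
    rcases a0 with rfl | ha
    · simp_all
    · simp_all
  apply hv
  ext i
  fin_cases i
  · exact hz.1
  · exact hz.2.1
  · exact hz.2.2

theorem map_le_map (e : A2 ≃ₗ⁅ℂ⁆ A2) {L S : LieSubalgebra ℂ A2} :
    L.map e.toLieHom ≤ S.map e.toLieHom ↔ L ≤ S := by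
  constructor
  · intro h X hX
    obtain ⟨Y, hY, hXY⟩ := h ⟨X, hX, rfl⟩
    rwa [← e.injective hXY]
  · rintro h _ ⟨X, hX, rfl⟩
    exact ⟨X, h hX, rfl⟩

theorem IsSemidirectSum.le_left {S R L : LieSubalgebra ℂ A2} (h : IsSemidirectSum S R L) :
    S ≤ L := fun X hX => by
  have : X ∈ S.toSubmodule ⊔ R.toSubmodule := Submodule.mem_sup_left hX
  rwa [h.sup_eq] at this

theorem IsSemidirectSum.le_right {S R L : LieSubalgebra ℂ A2} (h : IsSemidirectSum S R L) :
    R ≤ L := fun X hX => by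
  have : X ∈ S.toSubmodule ⊔ R.toSubmodule := Submodule.mem_sup_right hX
  rwa [h.sup_eq] at this

theorem IsLeviDecomposable.hasInvariantLine {L : LieSubalgebra ℂ A2} (h : IsLeviDecomposable L) :
    HasInvariantLine L ∨ HasInvariantLine (L.map negTranspose.toLieHom) := by
  obtain ⟨S, R, -, hR, -, hsol, hsum⟩ := h
  obtain ⟨W, h0, h1, hW⟩ := exists_invariant_submodule hR hsol hsum.le_right hsum.ideal
  exact hasInvariantLine_of_invariant_submodule h0 h1 hW

theorem not_isLeviDecomposable_of_A12_le {L : LieSubalgebra ℂ A2} (hL : A12 ≤ L) :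
    ¬ IsLeviDecomposable L := by
  intro h
  rcases h.hasInvariantLine with h | h
  · exact not_hasInvariantLine_A12 (h.mono hL)
  · exact not_hasInvariantLine_map_A12 (h.mono ((map_le_map negTranspose).2 hL))

/-! ### Subalgebras without abelian ideals -/

/-- `S` has no nonzero abelian ideal. -/
def NoAbelianIdeal (S : LieSubalgebra ℂ A2) : Prop :=
  ∀ N : Submodule ℂ A2, N ≤ S.toSubmodule → (∀ X ∈ S, ∀ Y ∈ N, ⁅X, Y⁆ ∈ N) →
    (∀ X ∈ N, ∀ Y ∈ N, ⁅X, Y⁆ = 0) → N = ⊥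

/-- The only consequence of semisimplicity used in the classification. Stating it for subspaces of
`A2` lets it be moved along automorphisms and applied to intersections. -/
theorem noAbelianIdeal_of_isSemisimple {S : LieSubalgebra ℂ A2}
    (hS : LieAlgebra.IsSemisimple ℂ S) : NoAbelianIdeal S := by
  intro N hNS hideal hab
  let I : LieIdeal ℂ S :=
    { N.comap S.toSubmodule.subtype with
      lie_mem := fun {X Y} hY => hideal X.1 X.2 Y.1 hY }
  have : IsLieAbelian I := ⟨fun X Y => by
    apply Subtype.ext
    apply Subtype.ext
    exact hab X.1.1 X.2 Y.1.1 Y.2⟩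
  have hbot : I = ⊥ := HasTrivialRadical.eq_bot_of_isSolvable I
  rw [eq_bot_iff]
  intro X hX
  have h1 : (⟨X, hNS hX⟩ : S) ∈ I := hX
  rw [hbot, LieSubmodule.mem_bot] at h1
  exact congrArg Subtype.val h1

theorem NoAbelianIdeal.map {S : LieSubalgebra ℂ A2} (h : NoAbelianIdeal S) (e : A2 ≃ₗ⁅ℂ⁆ A2) :
    NoAbelianIdeal (S.map e.toLieHom) := by
  intro N hNS hideal hab
  have hinj : Function.Injective e := e.injective
  have h0 : N.comap (e.toLinearEquiv : A2 →ₗ[ℂ] A2) = ⊥ := by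
    refine h _ ?_ ?_ ?_
    · intro X hX
      obtain ⟨Y, hY, hXY⟩ := hNS hX
      rwa [← hinj hXY]
    · intro X hX Y hY
      change e ⁅X, Y⁆ ∈ N
      rw [LieEquiv.map_lie]
      exact hideal _ ⟨X, hX, rfl⟩ _ hY
    · intro X hX Y hY
      apply hinj
      rw [LieEquiv.map_lie, map_zero]
      exact hab _ hX _ hY
  rw [eq_bot_iff]
  intro X hX
  have h1 : e.symm X ∈ N.comap (e.toLinearEquiv : A2 →ₗ[ℂ] A2) := by
    change e (e.symm X) ∈ N
    rwa [LieEquiv.apply_symm_apply]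
  rw [h0, Submodule.mem_bot] at h1
  have h2 := congrArg e h1
  rwa [LieEquiv.apply_symm_apply, map_zero] at h2

theorem exists_le_span_pair {V : Type*} [AddCommGroup V] [Module ℂ V] {S : Submodule ℂ V}
    [FiniteDimensional ℂ S] (h : Module.finrank ℂ S ≤ 2) :
    ∃ a b, a ∈ S ∧ b ∈ S ∧ ∀ x ∈ S, ∃ s t : ℂ, x = s • a + t • b := by
  obtain ⟨f, hf⟩ : ∃ f : (Fin 2 → ℂ) →ₗ[ℂ] S, Function.Surjective f := by
    -- Coordinates beyond the dimension are dropped, so dimensions 0, 1 and 2 are treated alike.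
    let e := (Module.finBasis ℂ S).equivFun.symm
    refine ⟨e.toLinearMap.comp (LinearMap.funLeft ℂ ℂ (Fin.castLE h)), ?_⟩
    exact e.surjective.comp (LinearMap.funLeft_surjective_of_injective ℂ ℂ _
      (Fin.castLE_injective h))
  refine ⟨f ![1, 0], f ![0, 1], (f _).2, (f _).2, fun x hx => ?_⟩
  obtain ⟨u, hu⟩ := hf ⟨x, hx⟩
  refine ⟨u 0, u 1, ?_⟩
  have e : u = u 0 • ![1, 0] + u 1 • ![0, 1] := by
    ext i
    fin_cases i <;> simp
  have := congrArg Subtype.val hu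
  rw [e, map_add, map_smul, map_smul] at this
  exact this.symm

/-- If a and b span S, all brackets are multiples of ⁅a, b⁆. The span of ⁅a, b⁆ is then an abelian
ideal, hence zero, so S is itself abelian and therefore zero. -/
theorem NoAbelianIdeal.three_le_finrank {S : LieSubalgebra ℂ A2} (h : NoAbelianIdeal S)
    (hS : S ≠ ⊥) : 3 ≤ Module.finrank ℂ S := by
  by_contra hlt
  obtain ⟨a, b, ha, hb, hab⟩ :=
    exists_le_span_pair (S := S.toSubmodule) (show Module.finrank ℂ S ≤ 2 by omega)
  have hbr : ∀ X ∈ S, ∀ Y ∈ S, ∃ t : ℂ, ⁅X, Y⁆ = t • ⁅a, b⁆ := by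
    intro X hX Y hY
    obtain ⟨s, t, rfl⟩ := hab X hX
    obtain ⟨s', t', rfl⟩ := hab Y hY
    refine ⟨s * t' - t * s', ?_⟩
    simp only [lie_add, add_lie, lie_smul, smul_lie, lie_self, ← lie_skew b a]
    module
  have h0 : Submodule.span ℂ {⁅a, b⁆} = ⊥ := by
    have hle : Submodule.span ℂ {⁅a, b⁆} ≤ S.toSubmodule := by
      rw [Submodule.span_singleton_le_iff_mem]
      exact S.lie_mem ha hb
    refine h _ hle ?_ ?_
    · intro X hX Y hY
      obtain ⟨t, ht⟩ := hbr X hX Y (hle hY)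
      rw [ht]
      exact Submodule.smul_mem _ _ (Submodule.mem_span_singleton_self _)
    · intro X hX Y hY
      obtain ⟨s, rfl⟩ := Submodule.mem_span_singleton.1 hX
      obtain ⟨t, rfl⟩ := Submodule.mem_span_singleton.1 hY
      rw [lie_smul, smul_lie, lie_self, smul_zero, smul_zero]
  rw [Submodule.span_singleton_eq_bot] at h0
  apply hS
  have h1 := h S.toSubmodule le_rfl (fun X hX Y hY => S.lie_mem hX hY) fun X hX Y hY => by
    obtain ⟨t, ht⟩ := hbr X hX Y hY
    rw [ht, h0, smul_zero]
  rwa [← LieSubalgebra.toSubmodule_inj]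

theorem lie_mem_rad2_of_levi4 {X Y : A2} (hX : X ∈ leviSubalgebra 4)
    (hY : Y ∈ gen {x₂, y₁}) : ⁅X, Y⁆ ∈ gen {x₂, y₁} := by
  rw [mem_levi4] at hX
  rw [mem_rad2] at hY ⊢
  obtain ⟨h1, h2⟩ := hX
  obtain ⟨k1, k2, k3, k4, k5, k6⟩ := hY
  have k7 : Y.val 2 2 = 0 := by rw [entry_two_two, k1, k6]; ring
  simp [lie_apply, h1, h2, k1, k2, k3, k4, k5, k6, k7]

/-- Induction along the derived series of the radical of `leviSubalgebra 4`: S meets its abelian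
derived part in an abelian ideal, hence in zero, and so the intersection of S with the whole radical
is abelian too. -/
theorem NoAbelianIdeal.eq_zero_of_mem_rad4 {S : LieSubalgebra ℂ A2} (h : NoAbelianIdeal S)
    (hS : S ≤ leviSubalgebra 4) {X : A2} (hX : X ∈ S) (hX' : X ∈ gen {h₁ - h₂, x₂, y₁}) :
    X = 0 := by
  have h2 : S.toSubmodule ⊓ (gen {x₂, y₁}).toSubmodule = ⊥ := by
    refine h _ inf_le_left ?_ ?_
    · intro X hX Y hY
      exact ⟨S.lie_mem hX hY.1, lie_mem_rad2_of_levi4 (hS hX) hY.2⟩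
    · intro X hX Y hY
      exact lie_eq_zero_of_rad2 hX.2 hY.2
  have h4 : S.toSubmodule ⊓ (gen {h₁ - h₂, x₂, y₁}).toSubmodule = ⊥ := by
    refine h _ inf_le_left ?_ ?_
    · intro X hX Y hY
      exact ⟨S.lie_mem hX hY.1, isSemidirectSum_levi4.ideal X (hS hX) Y hY.2⟩
    · intro X hX Y hY
      have : ⁅X, Y⁆ ∈ S.toSubmodule ⊓ (gen {x₂, y₁}).toSubmodule :=
        ⟨S.lie_mem hX.1 hY.1, lie_mem_rad2_of_rad4 hX.2 hY.2⟩
      rwa [h2, Submodule.mem_bot] at this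
  have : X ∈ S.toSubmodule ⊓ (gen {h₁ - h₂, x₂, y₁}).toSubmodule := ⟨hX, hX'⟩
  rwa [h4, Submodule.mem_bot] at this

/-- The coordinates of the `𝔰𝔩(2)`-part of a matrix. -/
def blockCoord : A2 →ₗ[ℂ] (Fin 3 → ℂ) where
  toFun X := ![X.val 0 0 - X.val 2 2, X.val 0 2, X.val 2 0]
  map_add' X Y := by
    ext i
    fin_cases i <;> simp; ring
  map_smul' c X := by
    ext i
    fin_cases i <;> simp; ring

theorem blockCoord_eq {X : A2} {a b c : ℂ} (h : blockCoord X = ![a, b, c]) :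
    X.val 0 0 - X.val 2 2 = a ∧ X.val 0 2 = b ∧ X.val 2 0 = c :=
  ⟨congrFun h 0, congrFun h 1, congrFun h 2⟩

/-- On `leviSubalgebra 4` the kernel of `blockCoord` is exactly the radical, which S meets in zero.
-/
theorem NoAbelianIdeal.eq_of_blockCoord_eq {S : LieSubalgebra ℂ A2} (h : NoAbelianIdeal S)
    (hS : S ≤ leviSubalgebra 4) {X Y : A2} (hX : X ∈ S) (hY : Y ∈ S)
    (hXY : blockCoord X = blockCoord Y) : X = Y := by
  rw [← sub_eq_zero]
  have hmem := S.sub_mem hX hY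
  have h4 := (mem_levi4 _).1 (hS hmem)
  refine h.eq_zero_of_mem_rad4 hS hmem ((mem_rad4 _).2 ?_)
  obtain ⟨e1, e2, e3⟩ := blockCoord_eq (X := X - Y) (a := 0) (b := 0) (c := 0) (by
    rw [map_sub, hXY, sub_self]
    ext i
    fin_cases i <;> rfl)
  exact ⟨e2, e3, h4.1, h4.2, sub_eq_zero.1 e1⟩

theorem NoAbelianIdeal.exists_sl2_triple {S : LieSubalgebra ℂ A2} (h : NoAbelianIdeal S)
    (h0 : S ≠ ⊥) (hS : S ≤ leviSubalgebra 4) :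
    ∃ H ∈ S, ∃ E ∈ S, ∃ F ∈ S, E ≠ 0 ∧ F ≠ 0 ∧ ⁅E, F⁆ = H ∧ ⁅H, E⁆ = (2 : ℂ) • E ∧
      ⁅H, F⁆ = (-2 : ℂ) • F ∧ blockCoord H = ![2, 0, 0] := by
  -- `blockCoord` is injective on S, and S has dimension at least 3, so S is a copy of the 𝔰𝔩(2)
  -- quotient. The relations of the lifted triple then need checking only in these three
  -- coordinates.
  have hsurj : Function.Surjective (blockCoord.comp S.toSubmodule.subtype) := by
    have hinj : Function.Injective (blockCoord.comp S.toSubmodule.subtype) := fun X Y hXY =>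
      Subtype.ext (h.eq_of_blockCoord_eq hS X.2 Y.2 hXY)
    have hle := LinearMap.finrank_le_finrank_of_injective hinj
    have h3 : 3 ≤ Module.finrank ℂ S.toSubmodule := h.three_le_finrank h0
    rw [Module.finrank_fin_fun] at hle
    exact (LinearMap.injective_iff_surjective_of_finrank_eq_finrank
      (by rw [Module.finrank_fin_fun]; omega)).1 hinj
  obtain ⟨⟨H, hH⟩, hHc⟩ := hsurj ![2, 0, 0]
  obtain ⟨⟨E, hE⟩, hEc⟩ := hsurj ![0, 1, 0]
  obtain ⟨⟨F, hF⟩, hFc⟩ := hsurj ![0, 0, 1]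
  change blockCoord H = _ at hHc
  change blockCoord E = _ at hEc
  change blockCoord F = _ at hFc
  obtain ⟨p1, p2, p3⟩ := blockCoord_eq hHc
  obtain ⟨q1, q2, q3⟩ := blockCoord_eq hEc
  obtain ⟨r1, r2, r3⟩ := blockCoord_eq hFc
  obtain ⟨p4, p5⟩ := (mem_levi4 _).1 (hS hH)
  obtain ⟨q4, q5⟩ := (mem_levi4 _).1 (hS hE)
  obtain ⟨r4, r5⟩ := (mem_levi4 _).1 (hS hF)
  have hcoord : ∀ X : A2, blockCoord X = ![X.val 0 0 - X.val 2 2, X.val 0 2, X.val 2 0] :=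
    fun _ => rfl
  refine ⟨H, hH, E, hE, F, hF, ?_, ?_, ?_, ?_, ?_, hHc⟩
  · rintro rfl
    simp at q2
  · rintro rfl
    simp at r3
  · refine h.eq_of_blockCoord_eq hS (S.lie_mem hE hF) hH ?_
    rw [hHc, hcoord]
    simp only [lie_apply, q2, q3, q4, q5, r2, r3, r4, r5]
    ext i
    fin_cases i
    · simp; ring
    · simp; linear_combination -r1
    · simp; linear_combination -q1
  · refine h.eq_of_blockCoord_eq hS (S.lie_mem hH hE) (S.smul_mem _ hE) ?_
    rw [map_smul, hEc, hcoord]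
    simp only [lie_apply, p2, p3, p4, p5, q2, q3, q4, q5]
    ext i
    fin_cases i
    · simp; ring
    · simp; linear_combination p1
    · simp
  · refine h.eq_of_blockCoord_eq hS (S.lie_mem hH hF) (S.smul_mem _ hF) ?_
    rw [map_smul, hFc, hcoord]
    simp only [lie_apply, p2, p3, p4, p5, r2, r3, r4, r5]
    ext i
    fin_cases i
    · simp; ring
    · simp
    · simp; linear_combination -p1

/-- The unipotent matrix that diagonalises `diag(1, 0, -1) + a y₁ + b x₂`. -/
def unipotent (a b : ℂ) : Matrix.SpecialLinearGroup (Fin 3) ℂ :=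
  ⟨!![1, 0, 0; a, 1, -b; 0, 0, 1], by simp [Matrix.det_fin_three]⟩

theorem innerAut_mem_levi4 (a b : ℂ) {X : A2} (hX : X ∈ leviSubalgebra 4) :
    innerAut (unipotent a b) X ∈ leviSubalgebra 4 := by
  rw [mem_levi4_iff_mulVec] at hX ⊢
  obtain ⟨c, hc⟩ := hX
  have e : (unipotent a b).val.mulVec ![0, 1, 0] = ![0, 1, 0] := by
    ext i
    fin_cases i <;> simp [unipotent, Matrix.mulVec, dotProduct, Fin.sum_univ_three]
  exact ⟨c, mulVec_innerAut (by rw [e, hc])⟩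

theorem eq_smul_x₃ {X : A2} (hX : X ∈ leviSubalgebra 4)
    (h : ⁅h₁ + h₂, X⁆ = (2 : ℂ) • X) : X = (-X.val 0 2) • x₃ := by
  obtain ⟨k1, k2⟩ := (mem_levi4 X).1 hX
  have e : ∀ i j, (⁅h₁ + h₂, X⁆ : A2).val i j = 2 * X.val i j := fun i j => by rw [h]; rfl
  have e00 := e 0 0
  have e11 := e 1 1
  have e10 := e 1 0
  have e12 := e 1 2
  have e20 := e 2 0
  have e22 := e 2 2
  simp only [lie_apply] at e00 e11 e10 e12 e20 e22
  simp [h₁, h₂, chevalley] at e00 e11 e10 e12 e20 e22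
  have f10 : X.val 1 0 = 0 := by linear_combination -e10 / 3
  have f12 : X.val 1 2 = 0 := by linear_combination -e12
  have f20 : X.val 2 0 = 0 := by linear_combination -e20 / 4
  apply A2_ext
  intro i j
  fin_cases i <;> fin_cases j <;> simp [x₃, chevalley, k1, k2, e00, e11, f10, f12, f20, e22]

theorem eq_smul_y₃ {X : A2} (hX : X ∈ leviSubalgebra 4)
    (h : ⁅h₁ + h₂, X⁆ = (-2 : ℂ) • X) : X = (-X.val 2 0) • y₃ := by
  obtain ⟨k1, k2⟩ := (mem_levi4 X).1 hX
  have e : ∀ i j, (⁅h₁ + h₂, X⁆ : A2).val i j = -2 * X.val i j := fun i j => by rw [h]; rfl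
  have e00 := e 0 0
  have e11 := e 1 1
  have e10 := e 1 0
  have e12 := e 1 2
  have e02 := e 0 2
  have e22 := e 2 2
  simp only [lie_apply] at e00 e11 e10 e12 e02 e22
  simp [h₁, h₂, chevalley] at e00 e11 e10 e12 e02 e22
  have f10 : X.val 1 0 = 0 := by linear_combination -e10
  have f12 : X.val 1 2 = 0 := by linear_combination e12 / 3
  have f02 : X.val 0 2 = 0 := by linear_combination e02 / 4
  apply A2_ext
  intro i j
  fin_cases i <;> fin_cases j <;> simp [y₃, chevalley, k1, k2, e00, e11, f10, f12, f02, e22]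

theorem mem_of_smul_mem {S : LieSubalgebra ℂ A2} {c : ℂ} {X : A2} (hc : c ≠ 0) (h : c • X ∈ S) :
    X ∈ S := by
  have := S.smul_mem c⁻¹ h
  rwa [smul_smul, inv_mul_cancel₀ hc, one_smul] at this

theorem NoAbelianIdeal.exists_A11_le {S : LieSubalgebra ℂ A2} (h : NoAbelianIdeal S)
    (h0 : S ≠ ⊥) (hS : S ≤ leviSubalgebra 4) :
    ∃ a b : ℂ, A11 ≤ S.map (innerAut (unipotent a b)).toLieHom := by
  obtain ⟨H, hH, E, hE, F, hF, hE0, hF0, hEF, hHE, hHF, hHc⟩ := h.exists_sl2_triple h0 hS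
  obtain ⟨p1, p2, p3⟩ := blockCoord_eq hHc
  obtain ⟨p4, p5⟩ := (mem_levi4 _).1 (hS hH)
  obtain ⟨q4, q5⟩ := (mem_levi4 _).1 (hS hE)
  obtain ⟨r4, r5⟩ := (mem_levi4 _).1 (hS hF)
  -- On the stabiliser of the middle line the middle diagonal entry is a character, so it vanishes
  -- on the commutator H.
  have p6 : H.val 1 1 = 0 := by
    rw [← hEF, lie_apply, q4, q5, r4, r5]
    ring
  have ht := trace_entries H
  have p7 : H.val 0 0 = 1 := by linear_combination (p1 + ht - p6) / 2
  have p8 : H.val 2 2 = -1 := by linear_combination (-p1 + ht - p6) / 2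
  -- The columns of `unipotent` at these entries are eigenvectors of H for 1, 0 and -1, so H becomes
  -- h₁ + h₂. The images of E and F are then weight vectors of weight 2 and -2, and those weight
  -- spaces are the lines of x₃ and y₃.
  refine ⟨H.val 1 0, H.val 1 2, ?_⟩
  set U := unipotent (H.val 1 0) (H.val 1 2) with hU
  have hUH : innerAut U H = h₁ + h₂ := by
    apply innerAut_eq
    ext i j
    simp only [Matrix.mul_apply, Fin.sum_univ_three]
    fin_cases i <;> fin_cases j <;>
      simp [hU, unipotent, h₁, h₂, chevalley, p2, p3, p4, p5, p6, p7, p8]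
  have hUE := eq_smul_x₃ (innerAut_mem_levi4 (H.val 1 0) (H.val 1 2) (hS hE)) (by
    rw [← hU, ← hUH, ← LieEquiv.map_lie, hHE, map_smul])
  have hUF := eq_smul_y₃ (innerAut_mem_levi4 (H.val 1 0) (H.val 1 2) (hS hF)) (by
    rw [← hU, ← hUH, ← LieEquiv.map_lie, hHF, map_smul])
  rw [← hU] at hUE hUF
  have key : ∀ {X Y : A2} {c : ℂ}, X ∈ S → X ≠ 0 → innerAut U X = c • Y →
      Y ∈ S.map (innerAut U).toLieHom := by
    intro X Y c hX hX0 hc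
    have hc0 : c ≠ 0 := by
      rintro rfl
      rw [zero_smul] at hc
      exact hX0 ((innerAut U).injective (hc.trans (map_zero (innerAut U)).symm))
    refine mem_of_smul_mem hc0 ?_
    rw [← hc]
    exact ⟨X, hX, rfl⟩
  apply LieSubalgebra.lieSpan_le.2
  rintro X (rfl | rfl | rfl)
  · exact key hE hE0 hUE
  · exact key hF hF0 hUF
  · exact ⟨H, hH, hUH⟩

/-! ### The classification -/

theorem eq_blockPart_add (X : A2) (h : X ∈ leviSubalgebra 4) : X = blockPart X +
    ((-X.val 1 1 / 2) • (h₁ - h₂) + (X.val 1 2 • x₂ + X.val 1 0 • y₁)) := by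
  obtain ⟨h1, h2⟩ := (mem_levi4 X).1 h
  apply A2_ext
  intro i j
  fin_cases i <;> fin_cases j <;>
    simp [blockPart, x₂, y₁, x₃, y₃, h₁, h₂, chevalley, h1, h2, entry_two_two X] <;> ring

/-- Modulo `A11` the three components are eigenvectors of ad(h₁ + h₂) for the distinct eigenvalues
0, 1 and -1, so combining X with its first and second brackets separates them. -/
theorem components_mem {L : LieSubalgebra ℂ A2} (hA : A11 ≤ L) (hL : L ≤ leviSubalgebra 4) {X : A2}
    (hX : X ∈ L) : X.val 1 1 • (h₁ - h₂) ∈ L ∧ X.val 1 2 • x₂ ∈ L ∧ X.val 1 0 • y₁ ∈ L := by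
  have e := eq_blockPart_add X (hL hX)
  have hh : h₁ + h₂ ∈ L := hA h_mem
  have h1 : (-X.val 1 1 / 2) • (h₁ - h₂) + (X.val 1 2 • x₂ + X.val 1 0 • y₁) ∈ L := by
    have := L.sub_mem hX (hA (blockPart_mem X))
    rwa [sub_eq_iff_eq_add'.2 e] at this
  have b1 : ⁅h₁ + h₂, h₁ - h₂⁆ = 0 := by
    apply A2_ext
    intro i j
    rw [lie_apply]
    fin_cases i <;> fin_cases j <;> simp [h₁, h₂, chevalley]
  have b2 : ⁅h₁ + h₂, x₂⁆ = x₂ := by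
    apply A2_ext
    intro i j
    rw [lie_apply]
    fin_cases i <;> fin_cases j <;> simp [h₁, h₂, x₂, chevalley]
  have b3 : ⁅h₁ + h₂, y₁⁆ = -y₁ := by
    apply A2_ext
    intro i j
    rw [lie_apply]
    fin_cases i <;> fin_cases j <;> simp [h₁, h₂, y₁, chevalley]
  have h2 := L.lie_mem hh h1
  have h3 := L.lie_mem hh h2
  simp only [lie_add, lie_smul, b1, b2, b3, smul_zero, zero_add, smul_neg, lie_neg, neg_neg] at h2 h3
  have hx : X.val 1 2 • x₂ ∈ L := by
    have := L.smul_mem (1 / 2 : ℂ) (L.add_mem h2 h3)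
    convert this using 1
    module
  have hy : X.val 1 0 • y₁ ∈ L := by
    have := L.sub_mem h3 hx
    rwa [add_sub_cancel_left] at this
  refine ⟨?_, hx, hy⟩
  have := L.smul_mem (-2 : ℂ) (L.sub_mem h1 h3)
  convert this using 1
  module

theorem x₂_mem_iff_y₁_mem {L : LieSubalgebra ℂ A2} (hA : A11 ≤ L) : x₂ ∈ L ↔ y₁ ∈ L := by
  constructor
  · intro h
    have e : y₁ = (-1 : ℂ) • ⁅x₂, y₃⁆ := by
      apply A2_ext
      intro i j
      change _ = (-1 : ℂ) * (⁅x₂, y₃⁆ : A2).val i j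
      rw [lie_apply]
      fin_cases i <;> fin_cases j <;> simp [x₂, y₁, y₃, chevalley]
    rw [e]
    exact L.smul_mem _ (L.lie_mem h (hA y₃_mem))
  · intro h
    have e : x₂ = (-1 : ℂ) • ⁅y₁, x₃⁆ := by
      apply A2_ext
      intro i j
      change _ = (-1 : ℂ) * (⁅y₁, x₃⁆ : A2).val i j
      rw [lie_apply]
      fin_cases i <;> fin_cases j <;> simp [x₂, y₁, x₃, chevalley]
    rw [e]
    exact L.smul_mem _ (L.lie_mem h (hA x₃_mem))

/-- L is determined by which of the two remaining `A11`-summands it contains: the line of h₁ - h₂,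
detected by the middle diagonal entry, and the irreducible plane of x₂ and y₁, detected by the rest
of the middle row. -/
theorem eq_levi_of_A11_le {L : LieSubalgebra ℂ A2} (hA : A11 ≤ L) (hL : L ≤ leviSubalgebra 4)
    (hLA : ¬ L ≤ A11) : L = leviSubalgebra 0 ∨ L = leviSubalgebra 2 ∨ L = leviSubalgebra 4 := by
  have hrow : ∀ X ∈ L, ¬ (X.val 1 0 = 0 ∧ X.val 1 2 = 0) → x₂ ∈ L ∧ y₁ ∈ L := by
    intro X hX h
    obtain ⟨-, hx, hy⟩ := components_mem hA hL hX
    by_cases h0 : X.val 1 0 = 0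
    · have h1 := mem_of_smul_mem (fun h1 => h ⟨h0, h1⟩) hx
      exact ⟨h1, (x₂_mem_iff_y₁_mem hA).1 h1⟩
    · have h1 := mem_of_smul_mem h0 hy
      exact ⟨(x₂_mem_iff_y₁_mem hA).2 h1, h1⟩
  by_cases hw : ∀ X ∈ L, X.val 1 0 = 0 ∧ X.val 1 2 = 0
  · left
    apply le_antisymm
    · intro X hX
      exact (mem_levi0 X).2 ⟨((mem_levi4 X).1 (hL hX)).1, ((mem_levi4 X).1 (hL hX)).2, hw X hX⟩
    · have hd : h₁ - h₂ ∈ L := by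
        by_contra hd
        apply hLA
        intro X hX
        obtain ⟨h1, h2⟩ := (mem_levi4 X).1 (hL hX)
        obtain ⟨h3, h4⟩ := hw X hX
        refine (mem_A11 X).2 ⟨h1, h2, h3, h4, ?_⟩
        by_contra h5
        exact hd (mem_of_smul_mem h5 (components_mem hA hL hX).1)
      refine sup_le hA (LieSubalgebra.lieSpan_le.2 ?_)
      rintro X rfl
      exact hd
  · right
    push Not at hw
    obtain ⟨Y, hY, hYr⟩ := hw
    obtain ⟨hx, hy⟩ := hrow Y hY (fun h => hYr h.1 h.2)
    by_cases hd : ∀ X ∈ L, X.val 1 1 = 0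
    · left
      apply le_antisymm
      · intro X hX
        exact (mem_levi2 X).2 ⟨((mem_levi4 X).1 (hL hX)).1, ((mem_levi4 X).1 (hL hX)).2, hd X hX⟩
      · refine sup_le hA (LieSubalgebra.lieSpan_le.2 ?_)
        rintro X (rfl | rfl)
        · exact hx
        · exact hy
    · right
      push Not at hd
      obtain ⟨Z, hZ, hZ0⟩ := hd
      have hh := mem_of_smul_mem hZ0 (components_mem hA hL hZ).1
      refine le_antisymm hL (sup_le hA (LieSubalgebra.lieSpan_le.2 ?_))
      rintro X (rfl | rfl | rfl)
      · exact hh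
      · exact hx
      · exact hy

theorem map_ne_bot {S : LieSubalgebra ℂ A2} (e : A2 ≃ₗ⁅ℂ⁆ A2) (h : S ≠ ⊥) :
    S.map e.toLieHom ≠ ⊥ := by
  intro h0
  apply h
  rw [LieSubalgebra.eq_bot_iff] at h0 ⊢
  intro X hX
  exact e.injective ((h0 (e X) ⟨X, hX, rfl⟩).trans (map_zero e).symm)

/-- Two conjugations are composed: one moves the invariant line to the middle axis, the other, a
unipotent preserving that axis, moves S so that it contains `A11`. -/
theorem equivalent_levi_of_hasInvariantLine {S L : LieSubalgebra ℂ A2} (hS : NoAbelianIdeal S)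
    (h0 : S ≠ ⊥) (hSL : S ≤ L) (hLS : ¬ L ≤ S) (hL : HasInvariantLine L) :
    Equivalent L (leviSubalgebra 0) ∨ Equivalent L (leviSubalgebra 2) ∨
      Equivalent L (leviSubalgebra 4) := by
  obtain ⟨v, hv, hL⟩ := hL
  obtain ⟨A, hA⟩ := exists_SL_mulVec_eq hv
  have hL4 : L.map (innerAut A).toLieHom ≤ leviSubalgebra 4 := by
    rintro _ ⟨X, hX, rfl⟩
    obtain ⟨c, hc⟩ := hL X hX
    exact mem_levi4_iff_mulVec.2 ⟨c, mulVec_innerAut (by rw [hA, hc])⟩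
  have hSL1 := (map_le_map (innerAut A)).2 hSL
  obtain ⟨a, b, hab⟩ := (hS.map (innerAut A)).exists_A11_le (map_ne_bot _ h0) (hSL1.trans hL4)
  have hequiv : Equivalent L ((L.map (innerAut A).toLieHom).map (innerAut (unipotent a b)).toLieHom) :=
    Equivalent.trans ⟨A, rfl⟩ ⟨unipotent a b, rfl⟩
  have key := eq_levi_of_A11_le
    (L := (L.map (innerAut A).toLieHom).map (innerAut (unipotent a b)).toLieHom)
    (hab.trans ((map_le_map _).2 hSL1)) (by
      rintro _ ⟨X, hX, rfl⟩
      exact innerAut_mem_levi4 a b (hL4 hX))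
    (fun h => hLS ((map_le_map _).1 ((map_le_map _).1 (h.trans hab))))
  rcases key with key | key | key
  · exact Or.inl (key ▸ hequiv)
  · exact Or.inr (Or.inl (key ▸ hequiv))
  · exact Or.inr (Or.inr (key ▸ hequiv))

theorem IsSemidirectSum.not_le_left {S R L : LieSubalgebra ℂ A2} (h : IsSemidirectSum S R L)
    (hR : R ≠ ⊥) : ¬ L ≤ S := by
  intro hLS
  apply hR
  rw [LieSubalgebra.eq_bot_iff]
  intro X hX
  have : X ∈ S.toSubmodule ⊓ R.toSubmodule := ⟨hLS (h.le_right hX), hX⟩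
  rwa [h.inf_eq_bot, Submodule.mem_bot] at this

theorem IsLeviDecomposable.exists_equivalent {L : LieSubalgebra ℂ A2} (h : IsLeviDecomposable L) :
    ∃ i, Equivalent L (leviSubalgebra i) := by
  have hline := h.hasInvariantLine
  obtain ⟨S, R, hS0, hR0, hss, -, hsum⟩ := h
  have hS := noAbelianIdeal_of_isSemisimple hss
  have hLS := hsum.not_le_left hR0
  rcases hline with hl | hl
  · rcases equivalent_levi_of_hasInvariantLine hS hS0 hsum.le_left hLS hl with h | h | h
    · exact ⟨0, h⟩
    · exact ⟨2, h⟩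
    · exact ⟨4, h⟩
  -- With an invariant plane the dual of L is classified instead; dualising back fixes number 0 and
  -- turns 2 and 4 into 1 and 3.
  · rcases equivalent_levi_of_hasInvariantLine (hS.map negTranspose) (map_ne_bot _ hS0)
      ((map_le_map negTranspose).2 hsum.le_left) (fun h => hLS ((map_le_map negTranspose).1 h)) hl
      with h | h | h
    · exact ⟨0, map_negTranspose_levi0 ▸ h.of_map_negTranspose⟩
    · exact ⟨1, map_negTranspose_levi2 ▸ h.of_map_negTranspose⟩
    · exact ⟨3, map_negTranspose_levi4 ▸ h.of_map_negTranspose⟩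

end LeviA2

end

open LeviA2
theorem mainTheorem1 :
    (∀ i, IsLeviDecomposable (leviSubalgebra i)) ∧
    (∀ L : LieSubalgebra ℂ A2, IsLeviDecomposable L → ∃ i, Equivalent L (leviSubalgebra i)) ∧
    (∀ i j, Equivalent (leviSubalgebra i) (leviSubalgebra j) → i = j) ∧
    IsDirectSum A11 (gen {h₁ - h₂}) (leviSubalgebra 0) ∧
    IsSemidirectSum A11 (gen {x₁, y₂}) (leviSubalgebra 1) ∧
    IsSemidirectSum A11 (gen {x₂, y₁}) (leviSubalgebra 2) ∧
    IsSemidirectSum A11 (gen {h₁ - h₂, x₁, y₂}) (leviSubalgebra 3) ∧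
    IsSemidirectSum A11 (gen {h₁ - h₂, x₂, y₁}) (leviSubalgebra 4) ∧
    Nonempty (leviSubalgebra 0 ≃ₗ⁅ℂ⁆ A1 × J) ∧
    Nonempty (leviSubalgebra 0 ≃ₗ⁅ℂ⁆ Matrix (Fin 2) (Fin 2) ℂ) ∧
    Nonempty (leviSubalgebra 1 ≃ₗ⁅ℂ⁆ (K1 ⋊⁅phi1⁆ A1)) ∧
    Nonempty (leviSubalgebra 2 ≃ₗ⁅ℂ⁆ (K1 ⋊⁅phi1⁆ A1)) ∧
    Nonempty (leviSubalgebra 3 ≃ₗ⁅ℂ⁆ (L2 ⋊⁅phi2⁆ A1)) ∧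
    Nonempty (leviSubalgebra 4 ≃ₗ⁅ℂ⁆ (L2 ⋊⁅phi2⁆ A1)) ∧
    Module.finrank ℂ (leviSubalgebra 1) = 5 ∧ Module.finrank ℂ (leviSubalgebra 2) = 5 ∧
    Module.finrank ℂ (leviSubalgebra 3) = 6 ∧ Module.finrank ℂ (leviSubalgebra 4) = 6 ∧
    (∀ L : LieSubalgebra ℂ A2, A12 ≤ L → ¬ IsLeviDecomposable L) :=
  ⟨isLeviDecomposable_levi, fun _ h => h.exists_equivalent, eq_of_equivalent_levi,
    isDirectSum_levi0, isSemidirectSum_levi1, isSemidirectSum_levi2, isSemidirectSum_levi3,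
    isSemidirectSum_levi4, nonempty_levi0_equiv_prod, nonempty_levi0_equiv_matrix,
    nonempty_levi1_equiv, nonempty_levi2_equiv, nonempty_levi3_equiv, nonempty_levi4_equiv,
    finrank_levi1, finrank_levi2, finrank_levi3, finrank_levi4,
    fun _ hL => not_isLeviDecomposable_of_A12_le hL⟩
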